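/- Let $A_0$ be an arbitrary infinite set and let $G_0$ be the group of all permutations of $A_0$. For $n\in\omega$ define recursively $$A_{n+1}:=A_n\cup\Bigl\{(n+1,p,\varepsilon): p\in\bigcup_{k=0}^{n+1}A_n^k,\ \varepsilon\in\{0,1\}\Bigr\}$$ (where the triples are formal objects that are not elements of $A_0$), and let $G_{n+1}$ be the group of all permutations $\sigma$ of $A_{n+1}$ for which there are $\pi_\sigma\in G_n$ and numbers $\varepsilon_{\sigma,p}\in\{0,1\}$ (for $p\in\bigcup_{k=0}^{n+1}A_n^k$) such that $\sigma(x)=\pi_\sigma(x)$ for all $x\in A_n$ and $$\sigma\bigl((n+1,p,\varepsilon)\bigr)=(n+1,\pi_\sigma(p),\varepsilon_{\sigma,p}+_2\varepsilon),$$ where $\pi_\sigma(\langle p_0,\dots,p_{l-1}\rangle)=\langle\pi_\sigma(p_0),\dots,\pi_\sigma(p_{l-1})\rangle$ and $+_2$ is addition modulo $2$. Let $A:=\bigcup_{n\in\omega}A_n$, and let $G$ be the group of all permutations $H$ of $A$ with $H|_{A_n}\in G_n$ for all $n\in\omega$. Let $\mathcal V$ be the permutation model determined by the set of atoms $A$,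 the group $G$ and finite supports: in the universe of sets built over the atoms $A$, on which $G$ acts by $\pi x=\{\pi y:y\in x\}$, an object $x$ is symmetric if there is a finite $E\subseteq A$ such that $\pi x=x$ for every $\pi\in G$ that fixes $E$ pointwise, and $\mathcal V$ is the class of all hereditarily symmetric objects. For a set $M$ write $[M]^2$ for the set of its two-element subsets, $\operatorname{fin}(M)$ for the set of its finite subsets and $\operatorname{iseq}(M)$ for the set of finite sequences without repetition of elements of $M$; for $\mathfrak m=|M|$ put $\mathfrak m^2=|M\times M|$, $[\mathfrak m]^2=|[M]^2|$, $\operatorname{fin}(\mathfrak m)=|\operatorname{fin}(M)|$ and $\operatorname{iseq}(\mathfrak m)=|\operatorname{iseq}(M)|$. Here $|X|<|Y|$ means that there is an injection from $X$ into $Y$ but no bijection between $X$ and $Y$. Then, for $\mathfrak m:=|A|$, $$\mathcal V\models\ \mathfrak m^2<\operatorname{iseq}(\mathfrak m)<[\mathfrak m]^2<\operatorname{fin}(\mathfrak m).$$ -/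

import Mathlib

universe u

/-! ## The universe of sets over a type of atoms -/

namespace ZFA

/-- Codes for the objects built from the atoms `A`: an atom, or a set given by an indexed family of
codes for its elements. -/
inductive PreObj (A : Type u) : Type (u + 1)
  | atom (a : A) : PreObj A
  | set (ι : Type u) (f : ι → PreObj A) : PreObj A

namespace PreObj

variable {A : Type u}

/-- Extensional equality of codes. An atom is different from every set, also from the empty set. -/
def Equiv : PreObj A → PreObj A → Prop
  | atom a, atom b => a = b
  | set _ f, set _ g => (∀ i, ∃ j, Equiv (f i) (g j)) ∧ (∀ j, ∃ i, Equiv (f i) (g j))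
  | atom _, set _ _ => False
  | set _ _, atom _ => False

theorem Equiv.refl (x : PreObj A) : Equiv x x := by
  induction x with
  | atom a => simp [Equiv]
  | set ι f ih => exact ⟨fun i => ⟨i, ih i⟩, fun i => ⟨i, ih i⟩⟩

theorem Equiv.symm {x y : PreObj A} (h : Equiv x y) : Equiv y x := by
  induction x generalizing y with
  | atom a => cases y <;> simp_all [Equiv]
  | set ι f ih =>
    cases y with
    | atom b => simp [Equiv] at h
    | set κ g =>
      refine ⟨fun j => ?_, fun i => ?_⟩
      · obtain ⟨i, hi⟩ := h.2 j
        exact ⟨i, ih i hi⟩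
      · obtain ⟨j, hj⟩ := h.1 i
        exact ⟨j, ih i hj⟩

theorem Equiv.trans {x y z : PreObj A} (h : Equiv x y) (h' : Equiv y z) : Equiv x z := by
  induction x generalizing y z with
  | atom a => cases y <;> cases z <;> simp_all [Equiv]
  | set ι f ih =>
    cases y with
    | atom b => simp [Equiv] at h
    | set κ g =>
      cases z with
      | atom c => simp [Equiv] at h'
      | set l k =>
        refine ⟨fun i => ?_, fun m => ?_⟩
        · obtain ⟨j, hj⟩ := h.1 i
          obtain ⟨m, hm⟩ := h'.1 j
          exact ⟨m, ih i hj hm⟩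
        · obtain ⟨j, hj⟩ := h'.2 m
          obtain ⟨i, hi⟩ := h.2 j
          exact ⟨i, ih i hi hj⟩

instance setoid (A : Type u) : Setoid (PreObj A) :=
  ⟨Equiv, Equiv.refl, Equiv.symm, Equiv.trans⟩

/-- `Mem x y`: the object coded by `y` is a set and the object coded by `x` is one of its
elements. -/
def Mem (x : PreObj A) : PreObj A → Prop
  | atom _ => False
  | set _ f => ∃ i, Equiv x (f i)

theorem Mem.congr {x x' y y' : PreObj A} (hx : Equiv x x') (hy : Equiv y y') (h : Mem x y) :
    Mem x' y' := by
  cases y with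
  | atom a => exact h.elim
  | set ι f =>
    cases y' with
    | atom b => exact hy.elim
    | set κ g =>
      obtain ⟨i, hi⟩ := h
      obtain ⟨j, hj⟩ := hy.1 i
      exact ⟨j, hx.symm.trans (hi.trans hj)⟩

/-- The action of a permutation of the atoms on codes. -/
def act (π : Equiv.Perm A) : PreObj A → PreObj A
  | atom a => atom (π a)
  | set ι f => set ι fun i => act π (f i)

theorem act_congr (π : Equiv.Perm A) {x y : PreObj A} (h : Equiv x y) :
    Equiv (act π x) (act π y) := by
  induction x generalizing y with
  | atom a => cases y <;> simp_all [Equiv, act]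
  | set ι f ih =>
    cases y with
    | atom b => simp [Equiv] at h
    | set κ g =>
      refine ⟨fun i => ?_, fun j => ?_⟩
      · obtain ⟨j, hj⟩ := h.1 i
        exact ⟨j, ih i hj⟩
      · obtain ⟨i, hi⟩ := h.2 j
        exact ⟨i, ih i hi⟩

end PreObj

/-- The universe of all objects (atoms and sets) over the atoms `A`. -/
def Obj (A : Type u) : Type (u + 1) := Quotient (PreObj.setoid A)

namespace Obj

variable {A : Type u}

/-- The atom `a` as an object. -/
def atom (a : A) : Obj A := Quotient.mk _ (PreObj.atom a)

/-- Membership. -/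
def Mem (x y : Obj A) : Prop :=
  Quotient.liftOn₂ x y PreObj.Mem fun _ _ _ _ hx hy =>
    propext ⟨PreObj.Mem.congr hx hy, PreObj.Mem.congr hx.symm hy.symm⟩

/-- The map `x ↦ π x` on the universe that is induced by a permutation `π` of the atoms:
`π x = {π y : y ∈ x}` for a set `x`. -/
def act (π : Equiv.Perm A) (x : Obj A) : Obj A :=
  Quotient.map (PreObj.act π) (fun _ _ h => PreObj.act_congr π h) x

/-- `x` has a finite support with respect to the group `G`. -/
def IsSymmetric (G : Subgroup (Equiv.Perm A)) (x : Obj A) : Prop :=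
  ∃ E : Finset A, ∀ π ∈ G, (∀ a ∈ E, π a = a) → act π x = x

/-- `x` is hereditarily symmetric: `x`, its elements, the elements of its elements, and so on, are
all symmetric. -/
inductive IsHereditarilySymmetric (G : Subgroup (Equiv.Perm A)) : Obj A → Prop
  | intro (x : Obj A) (hx : IsSymmetric G x)
      (h : ∀ y, Mem y x → IsHereditarilySymmetric G y) : IsHereditarilySymmetric G x

end Obj

/-! ## Structures for the language of set theory with atoms -/

/-- A structure for the language of set theory with atoms. -/
class AtomStructure (M : Type*) where
  /-- `mem x y`: the object `x` is an element of `y` -/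
  mem : M → M → Prop
  /-- `isAtom x`: the object `x` is an atom -/
  isAtom : M → Prop

instance AtomStructure.membership (M : Type*) [AtomStructure M] : Membership M M :=
  ⟨fun y x => AtomStructure.mem x y⟩

/-- The permutation model given by the group `G` and finite supports: the class of all
hereditarily symmetric objects. -/
def PermutationModel {A : Type u} (G : Subgroup (Equiv.Perm A)) : Type (u + 1) :=
  {x : Obj A // Obj.IsHereditarilySymmetric G x}

instance PermutationModel.atomStructure {A : Type u} (G : Subgroup (Equiv.Perm A)) :
    AtomStructure (PermutationModel G) where
  mem x y := Obj.Mem x.1 y.1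
  isAtom x := ∃ a, x.1 = Obj.atom a

/-! ## Set-theoretic notions, interpreted in a structure

All quantifiers range over the objects of the structure `M`, so each of the following is the truth
in `M` of the usual formula. -/

section Formulas

variable {M : Type*} [AtomStructure M]

/-- `x` is a set, that is, not an atom. -/
def IsSet (x : M) : Prop := ¬ AtomStructure.isAtom x

/-- `x` is the set of all atoms. -/
def IsSetOfAtoms (x : M) : Prop := IsSet x ∧ ∀ z, z ∈ x ↔ AtomStructure.isAtom z

/-- `z = {x, y}` -/
def IsUnorderedPair (z x y : M) : Prop := IsSet z ∧ ∀ w, w ∈ z ↔ w = x ∨ w = y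

/-- `z = ⟨x, y⟩ = {{x}, {x, y}}` -/
def IsOrderedPair (z x y : M) : Prop :=
  ∃ a b, IsUnorderedPair a x x ∧ IsUnorderedPair b x y ∧ IsUnorderedPair z a b

/-- `⟨x, y⟩ ∈ f` -/
def Maps (f x y : M) : Prop := ∃ z ∈ f, IsOrderedPair z x y

/-- `f` is a function from `X` to `Y`. -/
def IsFunction (f X Y : M) : Prop :=
  IsSet f ∧ (∀ z ∈ f, ∃ x ∈ X, ∃ y ∈ Y, IsOrderedPair z x y) ∧ ∀ x ∈ X, ∃! y, Maps f x y

/-- `f` is an injection from `X` into `Y`. -/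
def IsInjection (f X Y : M) : Prop :=
  IsFunction f X Y ∧ ∀ x x' y, Maps f x y → Maps f x' y → x = x'

/-- `f` is a bijection from `X` onto `Y`. -/
def IsBijection (f X Y : M) : Prop :=
  IsInjection f X Y ∧ ∀ y ∈ Y, ∃ x, Maps f x y

/-- `|X| ≤ |Y|` -/
def CardLE (X Y : M) : Prop := ∃ f, IsInjection f X Y

/-- `|X| = |Y|` -/
def CardEq (X Y : M) : Prop := ∃ f, IsBijection f X Y

/-- `|X| < |Y|` -/
def CardLT (X Y : M) : Prop := CardLE X Y ∧ ¬ CardEq X Y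

/-- `x = ∅` -/
def IsEmptySet (x : M) : Prop := IsSet x ∧ ∀ z, z ∉ x

/-- `y = x ∪ {x}` -/
def IsSuccessor (y x : M) : Prop := IsSet y ∧ ∀ z, z ∈ y ↔ z ∈ x ∨ z = x

/-- `w` contains `∅` and is closed under successors. -/
def IsInductive (w : M) : Prop :=
  (∃ e ∈ w, IsEmptySet e) ∧ ∀ x ∈ w, ∃ y ∈ w, IsSuccessor y x

/-- `n` is a natural number, that is, it belongs to the least inductive set `ω`. -/
def IsNatural (n : M) : Prop := ∃ w : M, IsInductive w ∧ n ∈ w ∧ ∀ v : M, IsInductive v → n ∈ v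

/-- `x` is finite: it is equinumerous with a natural number. -/
def IsFinite (x : M) : Prop := ∃ n, IsNatural n ∧ CardEq x n

/-- `P = X × X` -/
def IsSquare (P X : M) : Prop :=
  IsSet P ∧ ∀ z, z ∈ P ↔ ∃ x ∈ X, ∃ y ∈ X, IsOrderedPair z x y

/-- `S` is the set of all finite sequences without repetition of elements of `X`, that is, of all
injections from a natural number into `X`. -/
def IsIseq (S X : M) : Prop :=
  IsSet S ∧ ∀ s, s ∈ S ↔ ∃ n, IsNatural n ∧ IsInjection s n X

/-- `T` is the set of all two-element subsets of `X`. -/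
def IsTwoSubsets (T X : M) : Prop :=
  IsSet T ∧ ∀ z, z ∈ T ↔ ∃ x ∈ X, ∃ y ∈ X, x ≠ y ∧ IsUnorderedPair z x y

/-- `F` is the set of all finite subsets of `X`. -/
def IsFin (F X : M) : Prop :=
  IsSet F ∧ ∀ z, z ∈ F ↔ IsSet z ∧ (∀ x ∈ z, x ∈ X) ∧ IsFinite z

end Formulas

end ZFA

/-! ## The atoms and the group of the model -/

namespace ReflectedN

open ZFA

/-- Formal expressions from which the atoms are taken: elements of `A₀` and triples
`(n, p, ε)`. -/
inductive Expr (A₀ : Type u) : Type u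
  | base (a : A₀) : Expr A₀
  | triple (n : ℕ) (p : List (Expr A₀)) (ε : ZMod 2) : Expr A₀

variable (A₀ : Type u)

/-- The sets `A_n`. -/
def level : ℕ → Set (Expr A₀)
  | 0 => Set.range Expr.base
  | n + 1 => level n ∪
      {x | ∃ p : List (Expr A₀), (∀ y ∈ p, y ∈ level n) ∧ p.length ≤ n + 1 ∧
        ∃ ε : ZMod 2, x = Expr.triple (n + 1) p ε}

variable {A₀}

/-- The inclusion of `A_n` in `A_{n+1}`. -/
def incl {n : ℕ} (x : level A₀ n) : level A₀ (n + 1) := ⟨x.1, Or.inl x.2⟩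

/-- The element `(n+1, p, ε)` of `A_{n+1}`, for `p` a sequence in `A_n` of length at most `n+1`. -/
def new {n : ℕ} (p : List (level A₀ n)) (hp : p.length ≤ n + 1) (ε : ZMod 2) :
    level A₀ (n + 1) :=
  ⟨Expr.triple (n + 1) (p.map Subtype.val) ε, Or.inr ⟨p.map Subtype.val,
    fun y hy => by
      obtain ⟨z, _, rfl⟩ := List.mem_map.1 hy
      exact z.2,
    by simpa using hp, ε, rfl⟩⟩

/-- The groups `G_n` of permutations of `A_n`. -/
def levelGroup : (n : ℕ) → Subgroup (Equiv.Perm (level A₀ n))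
  | 0 => ⊤
  | n + 1 =>
    { carrier := {σ | ∃ π ∈ levelGroup n, ∃ e : List (level A₀ n) → ZMod 2,
        (∀ x, σ (incl x) = incl (π x)) ∧
        ∀ (p : List (level A₀ n)) (hp : p.length ≤ n + 1) (ε : ZMod 2),
          σ (new p hp ε) = new (p.map π) (by simpa using hp) (e p + ε)}
      one_mem' := ⟨1, one_mem _, 0, fun _ => rfl, fun p hp ε => by simp⟩
      mul_mem' := by
        rintro σ τ ⟨π, hπ, e, h1, h2⟩ ⟨ρ, hρ, d, k1, k2⟩
        refine ⟨π * ρ, mul_mem hπ hρ, fun p => e (p.map ρ) + d p, fun x => ?_, fun p hp ε => ?_⟩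
        · simp [k1, h1]
        · simp [k2, h2, add_assoc]
      inv_mem' := by
        rintro σ ⟨π, hπ, e, h1, h2⟩
        refine ⟨π⁻¹, inv_mem hπ, fun p => e (p.map ⇑π⁻¹), fun x => ?_, fun p hp ε => ?_⟩
        · rw [Equiv.Perm.inv_eq_iff_eq, h1]
          simp
        · rw [Equiv.Perm.inv_eq_iff_eq, h2]
          simp [← add_assoc, CharTwo.add_self_eq_zero] }

variable (A₀)

/-- The set `A` of atoms: the union of the sets `A_n`. -/
def Atom : Type u := {x : Expr A₀ // ∃ n, x ∈ level A₀ n}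

variable {A₀}

/-- The inclusion of `A_n` in `A`. -/
def toAtom {n : ℕ} (x : level A₀ n) : Atom A₀ := ⟨x.1, n, x.2⟩

variable (A₀)

/-- The group `G` of all permutations of `A` whose restriction to each `A_n` is in `G_n`. -/
def group : Subgroup (Equiv.Perm (Atom A₀)) where
  carrier := {H | ∀ n, ∃ σ ∈ levelGroup (A₀ := A₀) n, ∀ x, H (toAtom x) = toAtom (σ x)}
  one_mem' n := ⟨1, one_mem _, fun _ => rfl⟩
  mul_mem' := by
    intro H K hH hK n
    obtain ⟨σ, hσ, h⟩ := hH n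
    obtain ⟨τ, hτ, k⟩ := hK n
    exact ⟨σ * τ, mul_mem hσ hτ, fun x => by simp [h, k]⟩
  inv_mem' := by
    intro H hH n
    obtain ⟨σ, hσ, h⟩ := hH n
    refine ⟨σ⁻¹, inv_mem hσ, fun x => ?_⟩
    rw [Equiv.Perm.inv_eq_iff_eq, h]
    simp

/-- The permutation model with atoms `A`, group `G` and finite supports. -/
abbrev Model : Type (u + 1) := PermutationModel (group A₀)

end ReflectedN

/-! The injections come from maps that commute with `G`, so they have empty support. A pair `(a, b)`
goes to the sequence `[a, b]`, or to `[a]` if `a = b`. A sequence `p` goes to the pair of twins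
`{(n+1, p, 0), (n+1, p, 1)}`: an element of `G` moves the twins over `p` to the twins over the image
of `p`, and only their labels may be interchanged. Two-element sets of atoms are finite sets.

For strictness, let a bijection in the model have a support `F`. It may be enlarged to a finite set
closed under twins and under entries of index sequences. For such an `F`, the only atoms fixed by
the whole pointwise stabilizer of `F` are those of `F` (`mem_of_fixed`): a base atom outside can be
swapped with another one (`exists_swap`), a triple outside with its twin (`exists_flip`). Objects
matched by the bijection are fixed by the same elements of that stabilizer (`act_eq_of_maps`). The
three cases are then as follows.

Squares and sequences: sequences over `F` are matched with pairs over `F`, but there are `|F|²` such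
pairs and already `|F|² + 1` repetition-free sequences of length at most two.

Sequences and two-element sets: for every `n` the twins over the empty sequence form a pair fixed by
all of `G`. Their infinitely many partners would be repetition-free sequences over `F`, of which
there are finitely many.

Two-element sets and finite sets: take three base atoms outside `F`, forming a set `X`, and let `{x,
y}` be its partner. It is invariant under the elements that fix `F` pointwise and `X` setwise. This
forces `x` and `y` either to lie in `F` or to be twins over a sequence in `F`
(`exists_tripleAtom_of_stabilized`), so that `{x, y}` is invariant under the whole stabilizer of
`F`. But `X` is not, as one of its elements can be swapped with a base atom outside `F` and `X`. -/

namespace ZFA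

/-! ### The universe over the atoms: extensionality and the action of permutations. -/

namespace PreObj

variable {A : Type u}

theorem act_one (x : PreObj A) : act 1 x = x := by
  induction x with
  | atom a => rfl
  | set ι f ih => simp [act, ih]

theorem act_act (π ρ : Equiv.Perm A) (x : PreObj A) : act π (act ρ x) = act (π * ρ) x := by
  induction x with
  | atom a => rfl
  | set ι f ih => simp [act, ih]

end PreObj

namespace Obj

variable {A : Type u}

/-- The set of the values of a family of objects. -/
noncomputable def mk {ι : Type u} (f : ι → Obj A) : Obj A :=
  Quotient.mk _ (PreObj.set ι fun i => (f i).out)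

theorem mk_quotient {ι : Type u} (f : ι → PreObj A) :
    (Quotient.mk _ (PreObj.set ι f) : Obj A) = mk fun i => Quotient.mk _ (f i) :=
  have h (i : ι) : PreObj.Equiv (f i) (Quotient.mk (PreObj.setoid A) (f i)).out :=
    PreObj.Equiv.symm (Quotient.mk_out (s := PreObj.setoid A) (f i))
  Quotient.sound ⟨fun i => ⟨i, h i⟩, fun i => ⟨i, h i⟩⟩

theorem eq_atom_or_mk (x : Obj A) :
    (∃ a, x = atom a) ∨ ∃ (ι : Type u) (f : ι → Obj A), x = mk f := by
  induction x using Quotient.inductionOn with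
  | h x =>
    cases x with
    | atom a => exact Or.inl ⟨a, rfl⟩
    | set ι f => exact Or.inr ⟨ι, _, mk_quotient f⟩

theorem mem_mk {ι : Type u} {f : ι → Obj A} {z : Obj A} : Mem z (mk f) ↔ ∃ i, z = f i := by
  induction z using Quotient.inductionOn with
  | h z =>
    refine exists_congr fun i => ?_
    constructor
    · intro h
      rw [← Quotient.out_eq (f i)]
      exact Quotient.sound h
    · intro h
      rw [← Quotient.out_eq (f i)] at h
      exact Quotient.exact h

theorem not_mem_atom (z : Obj A) (a : A) : ¬ Mem z (atom a) := by
  induction z using Quotient.inductionOn with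
  | h z => exact id

theorem mk_ne_atom {ι : Type u} (f : ι → Obj A) (a : A) : mk f ≠ atom a :=
  fun h => (Quotient.exact h : PreObj.Equiv _ _)

theorem atom_injective : Function.Injective (atom : A → Obj A) :=
  fun _ _ h => (Quotient.exact h : PreObj.Equiv _ _)

theorem mk_eq_mk {ι κ : Type u} {f : ι → Obj A} {g : κ → Obj A}
    (h : ∀ z, (∃ i, z = f i) ↔ ∃ j, z = g j) : mk f = mk g := by
  have hout : ∀ x y : Obj A, x = y → PreObj.Equiv (Quotient.out x) (Quotient.out y) := by
    rintro x _ rfl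
    exact PreObj.Equiv.refl _
  refine Quotient.sound ⟨fun i => ?_, fun j => ?_⟩
  · obtain ⟨j, hj⟩ := (h (f i)).1 ⟨i, rfl⟩
    exact ⟨j, hout _ _ hj⟩
  · obtain ⟨i, hi⟩ := (h (g j)).2 ⟨j, rfl⟩
    exact ⟨i, hout _ _ hi.symm⟩

theorem ext {x y : Obj A} (hx : ¬ ∃ a, x = atom a) (hy : ¬ ∃ a, y = atom a)
    (h : ∀ z, Mem z x ↔ Mem z y) : x = y := by
  obtain ⟨ι, f, rfl⟩ := (eq_atom_or_mk x).resolve_left hx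
  obtain ⟨κ, g, rfl⟩ := (eq_atom_or_mk y).resolve_left hy
  exact mk_eq_mk fun z => by simpa [mem_mk] using h z

theorem act_atom (π : Equiv.Perm A) (a : A) : act π (atom a) = atom (π a) := rfl

theorem act_mk (π : Equiv.Perm A) {ι : Type u} (f : ι → Obj A) :
    act π (mk f) = mk fun i => act π (f i) := by
  have : act π (mk f) = Quotient.mk _ (PreObj.set ι fun i => PreObj.act π (f i).out) := rfl
  rw [this, mk_quotient]
  congr 1
  funext i
  conv_rhs => rw [← Quotient.out_eq (f i)]
  rfl

theorem act_one (x : Obj A) : act 1 x = x := by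
  induction x using Quotient.inductionOn with
  | h x => exact congrArg (Quotient.mk _) (PreObj.act_one x)

theorem act_act (π ρ : Equiv.Perm A) (x : Obj A) : act π (act ρ x) = act (π * ρ) x := by
  induction x using Quotient.inductionOn with
  | h x => exact congrArg (Quotient.mk _) (PreObj.act_act π ρ x)

theorem mem_act {π : Equiv.Perm A} {z x : Obj A} (h : Mem z x) : Mem (act π z) (act π x) := by
  obtain ⟨a, rfl⟩ | ⟨ι, f, rfl⟩ := eq_atom_or_mk x
  · exact (not_mem_atom _ _ h).elim
  · obtain ⟨i, rfl⟩ := mem_mk.1 h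
    rw [act_mk, mem_mk]
    exact ⟨i, rfl⟩

theorem exists_of_mem_act {π : Equiv.Perm A} {z x : Obj A} (h : Mem z (act π x)) :
    ∃ y, Mem y x ∧ z = act π y := by
  refine ⟨act π⁻¹ z, ?_, by simp [act_act, act_one]⟩
  simpa [act_act, act_one] using mem_act (π := π⁻¹) h

/-- If `E` supports `x`, then the image of `E` under `π` supports `π x`, by conjugation with `π`. -/
theorem IsSymmetric.act {G : Subgroup (Equiv.Perm A)} {x : Obj A} (hx : IsSymmetric G x)
    {π : Equiv.Perm A} (hπ : π ∈ G) : IsSymmetric G (act π x) := by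
  obtain ⟨E, hE⟩ := hx
  refine ⟨E.map π.toEmbedding, fun σ hσ h => ?_⟩
  have := hE (π⁻¹ * σ * π) (mul_mem (mul_mem (inv_mem hπ) hσ) hπ) fun a ha => by
    simp [h (π a) (Finset.mem_map_of_mem _ ha)]
  conv_rhs => rw [← this]
  rw [act_act, act_act]
  congr 1
  group

namespace IsHereditarilySymmetric

variable {G : Subgroup (Equiv.Perm A)} {x : Obj A}

theorem isSymmetric (hx : IsHereditarilySymmetric G x) : IsSymmetric G x := by
  cases hx; assumption

theorem of_mem (hx : IsHereditarilySymmetric G x) {y : Obj A} (h : Mem y x) :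
    IsHereditarilySymmetric G y := by
  cases hx with
  | intro _ _ h' => exact h' y h

theorem act (hx : IsHereditarilySymmetric G x) {π : Equiv.Perm A} (hπ : π ∈ G) :
    IsHereditarilySymmetric G (act π x) := by
  induction hx with
  | intro x hx _ ih =>
    refine ⟨_, hx.act hπ, fun y hy => ?_⟩
    obtain ⟨z, hz, rfl⟩ := exists_of_mem_act hy
    exact ih z hz

/-- Foundation, obtained from the inductive definition of hereditary symmetry. It serves to separate
the natural numbers of the model. -/
theorem not_mem_self (hx : IsHereditarilySymmetric G x) : ¬ Mem x x := by
  induction hx with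
  | intro x _ _ ih => exact fun h => ih x h h

end IsHereditarilySymmetric

end Obj

/-! ### Sets, pairs and functions inside a permutation model. -/

namespace PermutationModel

variable {A : Type u} {G : Subgroup (Equiv.Perm A)}

/-- The automorphism of the permutation model induced by an element of the group. -/
def act (π : G) (x : PermutationModel G) : PermutationModel G :=
  ⟨Obj.act π.1 x.1, x.2.act π.2⟩

theorem act_one (x : PermutationModel G) : act 1 x = x := Subtype.ext (Obj.act_one _)

theorem act_act (π ρ : G) (x : PermutationModel G) : act π (act ρ x) = act (π * ρ) x :=
  Subtype.ext (Obj.act_act _ _ _)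

@[simp]
theorem act_inv_act (π : G) (x : PermutationModel G) : act π⁻¹ (act π x) = x := by
  simp [act_act, act_one]

@[simp]
theorem act_act_inv (π : G) (x : PermutationModel G) : act π (act π⁻¹ x) = x := by
  simp [act_act, act_one]

theorem act_mem_act {π : G} {z x : PermutationModel G} : act π z ∈ act π x ↔ z ∈ x := by
  refine ⟨fun h => ?_, Obj.mem_act⟩
  have : act π⁻¹ (act π z) ∈ act π⁻¹ (act π x) := Obj.mem_act h
  simpa using this

theorem mem_act_iff {π : G} {z x : PermutationModel G} : z ∈ act π x ↔ act π⁻¹ z ∈ x := by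
  rw [← act_mem_act (π := π) (z := act π⁻¹ z), act_act_inv]

theorem notMem_self (x : PermutationModel G) : x ∉ x := x.2.not_mem_self

/-- An atom as an object of the permutation model. -/
def atom (a : A) : PermutationModel G :=
  ⟨Obj.atom a, ⟨_, ⟨{a}, fun π _ h => by rw [Obj.act_atom, h a (by simp)]⟩,
    fun _ h => (Obj.not_mem_atom _ _ h).elim⟩⟩

theorem isAtom_iff {x : PermutationModel G} : AtomStructure.isAtom x ↔ ∃ a, x = atom a :=
  exists_congr fun a => (Subtype.ext_iff (a1 := x) (a2 := atom a)).symm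

theorem atom_injective : Function.Injective (atom : A → PermutationModel G) :=
  fun _ _ h => Obj.atom_injective (congrArg Subtype.val h)

@[simp]
theorem atom_inj {a b : A} : (atom a : PermutationModel G) = atom b ↔ a = b :=
  atom_injective.eq_iff

@[simp]
theorem act_atom (π : G) (a : A) : act π (atom a) = atom (π.1 a) := rfl

theorem isSet_act {π : G} {x : PermutationModel G} (h : IsSet x) : IsSet (act π x) := by
  intro h'
  obtain ⟨a, ha⟩ := isAtom_iff.1 h'
  refine h (isAtom_iff.2 ⟨(π⁻¹).1 a, ?_⟩)
  rw [← act_inv_act π x, ha, act_atom]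

theorem ext {x y : PermutationModel G} (hx : IsSet x) (hy : IsSet y)
    (h : ∀ z, z ∈ x ↔ z ∈ y) : x = y :=
  Subtype.ext (Obj.ext hx hy fun z =>
    ⟨fun hz => (h ⟨z, x.2.of_mem hz⟩).1 hz, fun hz => (h ⟨z, y.2.of_mem hz⟩).2 hz⟩)

/-- Invariance of a family, as a set, under the elements of the group that fix `E` pointwise. -/
def FamilySupport {ι : Type*} (E : Finset A) (f : ι → PermutationModel G) : Prop :=
  ∀ π : G, (∀ a ∈ E, π.1 a = a) → ∀ i, ∃ j, act π (f i) = f j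

theorem exists_support (x : PermutationModel G) :
    ∃ E : Finset A, ∀ π : G, (∀ a ∈ E, π.1 a = a) → act π x = x := by
  obtain ⟨E, hE⟩ := x.2.isSymmetric
  exact ⟨E, fun π h => Subtype.ext (hE π.1 π.2 h)⟩

/-- The tool for forming sets in the model: the members are hereditarily symmetric already, so only
a finite support of the whole collection is needed. -/
theorem exists_mk {ι : Type*} [Small.{u} ι] (f : ι → PermutationModel G)
    (h : ∃ E, FamilySupport E f) :
    ∃ x : PermutationModel G, IsSet x ∧ ∀ z, z ∈ x ↔ ∃ i, z = f i := by
  obtain ⟨E, hE⟩ := h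
  have key : ∀ π : G, (∀ a ∈ E, π.1 a = a) → ∀ z : Obj A, (∃ i, z = (f i).1) →
      ∃ i, Obj.act π.1 z = (f i).1 := by
    rintro π hπ _ ⟨i, rfl⟩
    obtain ⟨j, hj⟩ := hE π hπ i
    exact ⟨j, congrArg Subtype.val hj⟩
  let x : Obj A := Obj.mk fun i : Shrink.{u} ι => (f ((equivShrink ι).symm i)).1
  have hmem : ∀ z, Obj.Mem z x ↔ ∃ i, z = (f i).1 := fun z => by
    rw [Obj.mem_mk, (equivShrink ι).symm.exists_congr_left]
    simp
  have hx : ¬ ∃ a, x = Obj.atom a := fun ⟨a, ha⟩ => Obj.mk_ne_atom _ a ha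
  refine ⟨⟨x, ⟨x, ⟨E, fun π hπ hfix => ?_⟩, fun y hy => ?_⟩⟩, hx, fun z => ?_⟩
  · refine Obj.ext ?_ hx fun z => ?_
    · rintro ⟨a, ha⟩
      simp only [x, Obj.act_mk] at ha
      exact Obj.mk_ne_atom _ a ha
    · rw [hmem]
      constructor
      · intro h
        obtain ⟨y, hy, rfl⟩ := Obj.exists_of_mem_act h
        exact key ⟨π, hπ⟩ hfix y ((hmem y).1 hy)
      · intro h
        -- `FamilySupport` gives only one inclusion; the other follows from it for the inverse
        -- permutation.
        have h' := key (⟨π, hπ⟩⁻¹) (fun a ha => by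
          simp [Equiv.symm_apply_eq, hfix a ha]) z h
        have := Obj.mem_act (π := π) ((hmem _).2 h')
        simpa [Obj.act_act, Obj.act_one] using this
  · obtain ⟨i, rfl⟩ := (hmem y).1 hy
    exact (f i).2
  · exact (hmem z.1).trans (exists_congr fun _ => Subtype.ext_iff.symm)

/-- The set of the values of a family with finite support. -/
noncomputable def mk {ι : Type*} [Small.{u} ι] (f : ι → PermutationModel G)
    (h : ∃ E, FamilySupport E f) : PermutationModel G := (exists_mk f h).choose

section

variable {ι : Type*} [Small.{u} ι] {f : ι → PermutationModel G} {h : ∃ E, FamilySupport E f}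

theorem isSet_mk : IsSet (mk f h) := (exists_mk f h).choose_spec.1

theorem mem_mk {z : PermutationModel G} : z ∈ mk f h ↔ ∃ i, z = f i :=
  (exists_mk f h).choose_spec.2 z

theorem act_mk_eq_mk {κ : Type*} [Small.{u} κ] {g : κ → PermutationModel G}
    {h' : ∃ E, FamilySupport E g} (π : G) (e : ι ≃ κ) (he : ∀ i, act π (f i) = g (e i)) :
    act π (mk f h) = mk g h' := by
  refine ext (isSet_act isSet_mk) isSet_mk fun z => ?_
  rw [mem_act_iff, mem_mk, mem_mk]
  constructor
  · rintro ⟨i, hi⟩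
    exact ⟨e i, by rw [← he, ← hi, act_act_inv]⟩
  · rintro ⟨j, rfl⟩
    exact ⟨e.symm j, by rw [← act_inv_act π (f _), he, e.apply_symm_apply]⟩

end

/-- The objects live one universe higher than the index types of sets; this makes the elements of
`x` usable as an index type, as in `succ`. -/
instance small_mem (x : PermutationModel G) : Small.{u} {z // z ∈ x} := by
  obtain ⟨a, ha⟩ | ⟨ι, f, hf⟩ := Obj.eq_atom_or_mk x.1
  · have : IsEmpty {z // z ∈ x} := ⟨fun z => Obj.not_mem_atom z.1.1 a (ha ▸ z.2)⟩
    infer_instance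
  · have h : ∀ z : {z // z ∈ x}, ∃ i, z.1.1 = f i := fun z => Obj.mem_mk.1 (hf ▸ z.2)
    choose g hg using h
    refine small_of_injective (f := g) fun z w hzw => Subtype.ext (Subtype.ext ?_)
    rw [hg, hg, hzw]

/-- The unordered pair. -/
noncomputable def upair (x y : PermutationModel G) : PermutationModel G :=
  mk (fun b : Bool => cond b x y) <| by
    classical
    obtain ⟨E, hE⟩ := exists_support x
    obtain ⟨F, hF⟩ := exists_support y
    refine ⟨E ∪ F, fun π h i => ⟨i, ?_⟩⟩
    cases i
    · exact hF π fun a ha => h a (by simp [ha])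
    · exact hE π fun a ha => h a (by simp [ha])

theorem mem_upair {x y z : PermutationModel G} : z ∈ upair x y ↔ z = x ∨ z = y := by
  simp [upair, mem_mk, or_comm]

theorem isUnorderedPair_iff {z x y : PermutationModel G} :
    IsUnorderedPair z x y ↔ z = upair x y := by
  constructor
  · exact fun h => ext h.1 isSet_mk fun w => by rw [h.2, mem_upair]
  · rintro rfl
    exact ⟨isSet_mk, fun w => mem_upair⟩

theorem upair_inj {x y z w : PermutationModel G} :
    upair x y = upair z w ↔ x = z ∧ y = w ∨ x = w ∧ y = z := by
  constructor
  · intro h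
    have h1 : ∀ t, t = x ∨ t = y ↔ t = z ∨ t = w := fun t => by
      rw [← mem_upair, h, mem_upair]
    have := h1 x
    have := h1 y
    have := h1 z
    have := h1 w
    grind
  · intro h
    refine ext isSet_mk isSet_mk fun t => ?_
    rw [mem_upair, mem_upair]
    grind

@[simp]
theorem act_upair (π : G) (x y : PermutationModel G) :
    act π (upair x y) = upair (act π x) (act π y) :=
  act_mk_eq_mk π (Equiv.refl _) fun i => by cases i <;> rfl

/-- The ordered pair. -/
noncomputable def opair (x y : PermutationModel G) : PermutationModel G :=
  upair (upair x x) (upair x y)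

theorem isOrderedPair_iff {z x y : PermutationModel G} :
    IsOrderedPair z x y ↔ z = opair x y := by
  simp [IsOrderedPair, isUnorderedPair_iff, opair]

theorem opair_inj {x y z w : PermutationModel G} :
    opair x y = opair z w ↔ x = z ∧ y = w := by
  simp only [opair, upair_inj]
  grind

@[simp]
theorem act_opair (π : G) (x y : PermutationModel G) :
    act π (opair x y) = opair (act π x) (act π y) := by
  simp [opair]

theorem maps_iff {f x y : PermutationModel G} : Maps f x y ↔ opair x y ∈ f := by
  simp [Maps, isOrderedPair_iff]

theorem maps_act {f x y : PermutationModel G} (π : G) (h : Maps f x y) :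
    Maps (act π f) (act π x) (act π y) := by
  rw [maps_iff] at h ⊢
  rw [← act_opair, act_mem_act]
  exact h

theorem isFunction_iff {f X Y : PermutationModel G} :
    IsFunction f X Y ↔ IsSet f ∧ (∀ z ∈ f, ∃ x ∈ X, ∃ y ∈ Y, z = opair x y) ∧
      ∀ x ∈ X, ∃! y, opair x y ∈ f := by
  simp only [IsFunction, isOrderedPair_iff, maps_iff]

theorem _root_.ZFA.IsFunction.maps_unique {f X Y x y z : PermutationModel G} (h : IsFunction f X Y)
    (hy : Maps f x y) (hz : Maps f x z) : y = z := by
  obtain ⟨_, hmem, hun⟩ := isFunction_iff.1 h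
  rw [maps_iff] at hy hz
  obtain ⟨x', hx', _, _, he⟩ := hmem _ hy
  rw [opair_inj] at he
  obtain ⟨rfl, _⟩ := he
  exact (hun x hx').unique hy hz

theorem _root_.ZFA.IsFunction.mem_of_maps {f X Y x y : PermutationModel G} (h : IsFunction f X Y)
    (hy : Maps f x y) : x ∈ X ∧ y ∈ Y := by
  obtain ⟨_, hmem, _⟩ := isFunction_iff.1 h
  rw [maps_iff] at hy
  obtain ⟨x', hx', y', hy', he⟩ := hmem _ hy
  rw [opair_inj] at he
  exact ⟨he.1 ▸ hx', he.2 ▸ hy'⟩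

/-- Two families that determine each other and are permuted in parallel define an injection in the
permutation model. -/
theorem exists_injection {ι : Type*} [Small.{u} ι] (a b : ι → PermutationModel G)
    {X Y : PermutationModel G} (hX : ∀ z, z ∈ X ↔ ∃ i, z = a i) (hY : ∀ i, b i ∈ Y)
    (hab : ∀ i j, a i = a j ↔ b i = b j) (E : Finset A)
    (hE : ∀ π : G, (∀ x ∈ E, π.1 x = x) → ∀ i, ∃ j, act π (a i) = a j ∧ act π (b i) = b j) :
    ∃ f, IsInjection f X Y ∧ ∀ x y, Maps f x y ↔ ∃ i, x = a i ∧ y = b i := by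
  have hs : ∃ E, FamilySupport E fun i => opair (a i) (b i) :=
    ⟨E, fun π h i => by
      obtain ⟨j, h1, h2⟩ := hE π h i
      exact ⟨j, by rw [act_opair, h1, h2]⟩⟩
  have hmaps : ∀ x y, Maps (mk (fun i => opair (a i) (b i)) hs) x y ↔
      ∃ i, x = a i ∧ y = b i := fun x y => by
    simp only [maps_iff, mem_mk, opair_inj]
  refine ⟨mk (fun i => opair (a i) (b i)) hs, ⟨⟨isSet_mk, fun z hz => ?_, fun x hx => ?_⟩,
    fun x x' y h h' => ?_⟩, hmaps⟩
  · obtain ⟨i, rfl⟩ := mem_mk.1 hz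
    exact ⟨a i, (hX _).2 ⟨i, rfl⟩, b i, hY i, isOrderedPair_iff.2 rfl⟩
  · obtain ⟨i, rfl⟩ := (hX _).1 hx
    refine ⟨b i, (hmaps _ _).2 ⟨i, rfl, rfl⟩, fun y hy => ?_⟩
    obtain ⟨j, hj, rfl⟩ := (hmaps _ _).1 hy
    exact ((hab i j).1 hj).symm
  · obtain ⟨i, rfl, rfl⟩ := (hmaps _ _).1 h
    obtain ⟨j, rfl, hj⟩ := (hmaps _ _).1 h'
    exact (hab i j).2 hj

end PermutationModel

end ZFA

/-! ### Natural numbers, finite sequences and finite sets of atoms in the model. -/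

namespace ZFA

namespace PermutationModel

variable {A : Type u} {G : Subgroup (Equiv.Perm A)}

/-- The empty set. -/
noncomputable def empty : PermutationModel G := mk (Empty.elim) ⟨∅, fun _ _ i => i.elim⟩

theorem isEmptySet_iff {x : PermutationModel G} : IsEmptySet x ↔ x = empty := by
  have h : ∀ z, z ∉ (empty : PermutationModel G) := fun z hz => (mem_mk.1 hz).choose.elim
  constructor
  · exact fun hx => ext hx.1 isSet_mk fun z => by simp [hx.2 z, h z]
  · rintro rfl
    exact ⟨isSet_mk, h⟩

/-- The set `x ∪ {x}`. -/
noncomputable def succ (x : PermutationModel G) : PermutationModel G :=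
  mk (Sum.elim Subtype.val fun _ => x : {z // z ∈ x} ⊕ Unit → PermutationModel G) <| by
    obtain ⟨E, hE⟩ := exists_support x
    refine ⟨E, fun π h o => ?_⟩
    cases o with
    | inr o => exact ⟨Sum.inr o, hE π h⟩
    | inl z =>
      refine ⟨Sum.inl ⟨act π z.1, ?_⟩, rfl⟩
      have := (act_mem_act (π := π)).2 z.2
      rwa [hE π h] at this

theorem mem_succ {x z : PermutationModel G} : z ∈ succ x ↔ z ∈ x ∨ z = x := by
  simp [succ, mem_mk]

theorem isSuccessor_iff {y x : PermutationModel G} : IsSuccessor y x ↔ y = succ x := by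
  constructor
  · exact fun h => ext h.1 isSet_mk fun z => by rw [h.2, mem_succ]
  · rintro rfl
    exact ⟨isSet_mk, fun z => mem_succ⟩

/-- The natural numbers of the permutation model. -/
noncomputable def nat : ℕ → PermutationModel G
  | 0 => empty
  | n + 1 => succ (nat n)

theorem mem_nat {n : ℕ} {z : PermutationModel G} : z ∈ nat n ↔ ∃ i < n, z = nat i := by
  induction n with
  | zero => simpa [nat] using (isEmptySet_iff.2 rfl).2 z
  | succ n ih =>
    rw [nat, mem_succ, ih]
    simp only [Nat.lt_succ_iff_lt_or_eq]
    grind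

theorem isSet_nat (n : ℕ) : IsSet (nat n : PermutationModel G) := by
  cases n with
  | zero => exact (isEmptySet_iff.2 rfl).1
  | succ n => exact (isSuccessor_iff.2 rfl).1

theorem nat_injective : Function.Injective (nat : ℕ → PermutationModel G) := by
  intro m n h
  by_contra hne
  rcases Nat.lt_or_gt_of_ne hne with hlt | hlt
  · have : nat m ∈ (nat n : PermutationModel G) := mem_nat.2 ⟨m, hlt, rfl⟩
    exact notMem_self _ (h ▸ this)
  · have : nat n ∈ (nat m : PermutationModel G) := mem_nat.2 ⟨n, hlt, rfl⟩
    exact notMem_self _ (h ▸ this)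

@[simp]
theorem nat_inj {m n : ℕ} : (nat m : PermutationModel G) = nat n ↔ m = n := nat_injective.eq_iff

@[simp]
theorem act_nat (π : G) (n : ℕ) : act π (nat n) = nat n := by
  induction n using Nat.strong_induction_on with
  | _ n ih =>
    refine ext (isSet_act (isSet_nat n)) (isSet_nat n) fun z => ?_
    rw [mem_act_iff, mem_nat, mem_nat]
    refine exists_congr fun i => and_congr_right fun hi => ?_
    constructor
    · intro h
      rw [← act_act_inv π z, h, ih i hi]
    · rintro rfl
      rw [← act_inv_act π (nat i), ih i hi]
      conv_lhs => rw [← ih i hi, act_inv_act]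

/-- The model has the standard natural numbers: each `nat n` is fixed by the group, so they form an
inductive set of the model, and it is the least one. -/
theorem isNatural_iff {x : PermutationModel G} : IsNatural x ↔ ∃ n, x = nat n := by
  have hs : ∃ E, FamilySupport E (nat : ℕ → PermutationModel G) :=
    ⟨∅, fun π _ n => ⟨n, act_nat π n⟩⟩
  have hω : IsInductive (mk nat hs) := by
    refine ⟨⟨nat 0, mem_mk.2 ⟨0, rfl⟩, isEmptySet_iff.2 rfl⟩, fun x hx => ?_⟩
    obtain ⟨n, rfl⟩ := mem_mk.1 hx
    exact ⟨nat (n + 1), mem_mk.2 ⟨n + 1, rfl⟩, isSuccessor_iff.2 rfl⟩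
  constructor
  · rintro ⟨_, _, _, h⟩
    exact mem_mk.1 (h _ hω)
  · rintro ⟨n, rfl⟩
    refine ⟨mk nat hs, hω, mem_mk.2 ⟨n, rfl⟩, fun v hv => ?_⟩
    induction n with
    | zero =>
      obtain ⟨e, he, h⟩ := hv.1
      rwa [isEmptySet_iff.1 h] at he
    | succ n ih =>
      obtain ⟨y, hy, h⟩ := hv.2 _ ih
      rwa [isSuccessor_iff.1 h] at hy

variable (G) in
/-- The set of all atoms. -/
noncomputable def atoms : PermutationModel G :=
  mk (atom : A → PermutationModel G) ⟨∅, fun π _ a => ⟨π.1 a, rfl⟩⟩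

theorem mem_atoms {x : PermutationModel G} : x ∈ atoms G ↔ ∃ a, x = atom a := mem_mk

theorem isSetOfAtoms_atoms : IsSetOfAtoms (atoms G) :=
  ⟨isSet_mk, fun _ => mem_atoms.trans isAtom_iff.symm⟩

/-- The finite sequence of atoms given by a list, as an object of the permutation model. -/
noncomputable def seq (l : List A) : PermutationModel G :=
  mk (fun i : Fin l.length => opair (nat i) (atom (l.get i))) <| by
    classical
    exact ⟨l.toFinset, fun π h i => ⟨i, by
      rw [act_opair, act_nat, act_atom, h (l.get i) (by simp)]⟩⟩

theorem opair_mem_seq {l : List A} {x y : PermutationModel G} :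
    opair x y ∈ seq l ↔ ∃ i : Fin l.length, x = nat i ∧ y = atom (l.get i) := by
  simp only [seq, mem_mk, opair_inj]

theorem seq_injective : Function.Injective (seq : List A → PermutationModel G) := by
  have key : ∀ l l' : List A, (seq l : PermutationModel G) = seq l' → ∀ i (hi : i < l.length),
      ∃ hi' : i < l'.length, l[i] = l'[i] := by
    intro l l' h i hi
    have h1 : opair (nat i) (atom l[i]) ∈ (seq l' : PermutationModel G) :=
      h ▸ opair_mem_seq.2 ⟨⟨i, hi⟩, rfl, rfl⟩
    obtain ⟨j, hj, ha⟩ := opair_mem_seq.1 h1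
    rw [nat_inj] at hj
    subst hj
    exact ⟨j.2, atom_injective ha⟩
  intro l l' h
  refine List.ext_getElem (le_antisymm ?_ ?_) fun i hi _ => (key l l' h i hi).2
  · exact le_of_forall_lt fun i hi => (key l l' h i hi).1
  · exact le_of_forall_lt fun i hi => (key l' l h.symm i hi).1

@[simp]
theorem act_seq (π : G) (l : List A) : act π (seq l) = seq (l.map π.1) :=
  act_mk_eq_mk π (finCongr (by simp)) fun i => by simp

/-- Every list of atoms is in the model, being supported by its finitely many entries; so internal
and external finite sequences agree. -/
theorem isInjection_seq_iff {n : ℕ} {s : PermutationModel G} :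
    IsInjection s (nat n) (atoms G) ↔ ∃ l : List A, l.Nodup ∧ l.length = n ∧ s = seq l := by
  constructor
  · rintro ⟨hf, hinj⟩
    have h : ∀ i : Fin n, ∃ a : A, Maps s (nat i) (atom a) := fun i => by
      obtain ⟨y, hy, _⟩ := hf.2.2 (nat i) (mem_nat.2 ⟨i, i.2, rfl⟩)
      obtain ⟨a, rfl⟩ := mem_atoms.1 (hf.mem_of_maps hy).2
      exact ⟨a, hy⟩
    choose g hg using h
    refine ⟨List.ofFn g, ?_, by simp, ext hf.1 isSet_mk fun z => ?_⟩
    · refine List.nodup_ofFn.2 fun i j hij => Fin.ext ?_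
      exact nat_injective (hinj _ _ _ (hg i) (hij ▸ hg j))
    · constructor
      · intro hz
        obtain ⟨x, hx, y, hy, hxy⟩ := hf.2.1 z hz
        rw [isOrderedPair_iff] at hxy
        obtain ⟨i, hi, rfl⟩ := mem_nat.1 hx
        have : y = atom (g ⟨i, hi⟩) :=
          hf.maps_unique (maps_iff.2 (hxy ▸ hz)) (hg ⟨i, hi⟩)
        rw [hxy, opair_mem_seq]
        exact ⟨⟨i, by simpa using hi⟩, rfl, by simp [this]⟩
      · intro hz
        obtain ⟨i, rfl⟩ := mem_mk.1 hz
        simpa using maps_iff.1 (hg ⟨i, by simpa using i.2⟩)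
  · rintro ⟨l, hl, rfl, rfl⟩
    refine ⟨isFunction_iff.2 ⟨isSet_mk, fun z hz => ?_, fun x hx => ?_⟩, fun x x' y h h' => ?_⟩
    · obtain ⟨i, rfl⟩ := mem_mk.1 hz
      exact ⟨_, mem_nat.2 ⟨i, i.2, rfl⟩, _, mem_atoms.2 ⟨_, rfl⟩, rfl⟩
    · obtain ⟨i, hi, rfl⟩ := mem_nat.1 hx
      refine ⟨atom l[i], opair_mem_seq.2 ⟨⟨i, hi⟩, rfl, rfl⟩, fun y hy => ?_⟩
      obtain ⟨j, hj, rfl⟩ := opair_mem_seq.1 hy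
      rw [nat_inj] at hj
      subst hj
      rfl
    · obtain ⟨i, rfl, rfl⟩ := opair_mem_seq.1 (maps_iff.1 h)
      obtain ⟨j, rfl, hj⟩ := opair_mem_seq.1 (maps_iff.1 h')
      rw [hl.get_inj_iff.1 (atom_injective hj)]

/-- A finite set of atoms as an object of the permutation model. -/
noncomputable def ofFinset (S : Finset A) : PermutationModel G :=
  mk (fun a : S => atom a.1) ⟨S, fun π h a => ⟨a, by simp [h a.1 a.2]⟩⟩

theorem atom_mem_ofFinset {S : Finset A} {a : A} :
    (atom a : PermutationModel G) ∈ ofFinset S ↔ a ∈ S := by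
  simp [ofFinset, mem_mk]

theorem mem_ofFinset {S : Finset A} {x : PermutationModel G} :
    x ∈ ofFinset S ↔ ∃ a ∈ S, x = atom a := by
  simp [ofFinset, mem_mk]

theorem ofFinset_injective : Function.Injective (ofFinset : Finset A → PermutationModel G) :=
  fun S T h => Finset.ext fun a => by
    rw [← atom_mem_ofFinset (G := G), h, atom_mem_ofFinset]

@[simp]
theorem act_ofFinset (π : G) (S : Finset A) :
    act π (ofFinset S) = ofFinset (S.map π.1.toEmbedding) :=
  ext (isSet_act isSet_mk) isSet_mk fun z => by
    rw [mem_act_iff, mem_ofFinset, mem_ofFinset]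
    constructor
    · rintro ⟨a, ha, h⟩
      exact ⟨π.1 a, by simpa using ha, by rw [← act_atom, ← h, act_act_inv]⟩
    · rintro ⟨a, ha, rfl⟩
      exact ⟨(π⁻¹).1 a, by simpa [Finset.mem_map_equiv] using ha, rfl⟩

theorem upair_atom_eq_ofFinset [DecidableEq A] (a b : A) :
    (upair (atom a) (atom b) : PermutationModel G) = ofFinset {a, b} :=
  ext isSet_mk isSet_mk fun z => by simp [mem_upair, mem_ofFinset]

theorem isFinite_ofFinset (S : Finset A) : IsFinite (ofFinset S : PermutationModel G) := by
  refine ⟨nat S.card, isNatural_iff.2 ⟨_, rfl⟩, ?_⟩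
  obtain ⟨f, hf, hmaps⟩ := exists_injection (ι := S) (fun a => (atom a.1 : PermutationModel G))
    (fun a => nat (S.equivFin a)) (X := ofFinset S) (Y := nat S.card) (fun z => mem_mk)
    (fun a => mem_nat.2 ⟨_, (S.equivFin a).2, rfl⟩)
    (fun a b => by
      rw [atom_inj, nat_inj, Fin.val_inj, S.equivFin.injective.eq_iff, Subtype.ext_iff]) S
    -- An enumeration of `S` is supported by `S` itself.
    (fun π h a => ⟨a, by simp [h a.1 a.2], by simp⟩)
  refine ⟨f, hf, fun y hy => ?_⟩
  obtain ⟨i, hi, rfl⟩ := mem_nat.1 hy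
  exact ⟨_, (hmaps _ _).2 ⟨S.equivFin.symm ⟨i, hi⟩, rfl, by simp⟩⟩

theorem isFinite_subset_atoms_iff {z : PermutationModel G} :
    (IsSet z ∧ (∀ x ∈ z, x ∈ atoms G) ∧ IsFinite z) ↔ ∃ S : Finset A, z = ofFinset S := by
  constructor
  · rintro ⟨hset, hsub, n, hn, f, ⟨hf, hinj⟩, _⟩
    obtain ⟨n, rfl⟩ := isNatural_iff.1 hn
    have h : ∀ a : {a : A | atom a ∈ z}, ∃ i : Fin n, Maps f (atom a.1) (nat i) := fun a => by
      obtain ⟨y, hy, _⟩ := hf.2.2 _ a.2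
      obtain ⟨i, hi, rfl⟩ := mem_nat.1 (hf.mem_of_maps hy).2
      exact ⟨⟨i, hi⟩, hy⟩
    choose g hg using h
    have hfin : {a : A | (atom a : PermutationModel G) ∈ z}.Finite :=
      Finite.of_injective g fun a b hab =>
        Subtype.ext (atom_injective (hinj _ _ _ (hg a) (hab ▸ hg b)))
    refine ⟨hfin.toFinset, ext hset isSet_mk fun x => ?_⟩
    rw [mem_ofFinset]
    constructor
    · intro hx
      obtain ⟨a, rfl⟩ := mem_atoms.1 (hsub x hx)
      exact ⟨a, by simpa using hx, rfl⟩
    · rintro ⟨a, ha, rfl⟩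
      simpa using ha
  · rintro ⟨S, rfl⟩
    refine ⟨isSet_mk, fun x hx => ?_, isFinite_ofFinset S⟩
    obtain ⟨a, _, rfl⟩ := mem_ofFinset.1 hx
    exact mem_atoms.2 ⟨a, rfl⟩

variable (G)

/-- The set of all ordered pairs of atoms. -/
noncomputable def square : PermutationModel G :=
  mk (fun x : A × A => opair (atom x.1) (atom x.2))
    ⟨∅, fun π _ x => ⟨(π.1 x.1, π.1 x.2), by simp⟩⟩

/-- The set of all finite sequences of atoms without repetition. -/
noncomputable def iseq : PermutationModel G :=
  mk (fun l : {l : List A // l.Nodup} => seq l.1)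
    ⟨∅, fun π _ l => ⟨⟨l.1.map π.1, l.2.map π.1.injective⟩, by simp⟩⟩

/-- The set of all two-element sets of atoms. -/
noncomputable def twoSubsets : PermutationModel G :=
  mk (fun x : {x : A × A // x.1 ≠ x.2} => upair (atom x.1.1) (atom x.1.2))
    ⟨∅, fun π _ x => ⟨⟨(π.1 x.1.1, π.1 x.1.2), by simpa using x.2⟩, by simp⟩⟩

/-- The set of all finite sets of atoms. -/
noncomputable def finiteSubsets : PermutationModel G :=
  mk (ofFinset : Finset A → PermutationModel G)
    ⟨∅, fun π _ S => ⟨S.map π.1.toEmbedding, by simp⟩⟩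

variable {G}

theorem isSquare_square : IsSquare (square G) (atoms G) := by
  refine ⟨isSet_mk, fun z => ?_⟩
  simp only [square, mem_mk, mem_atoms, isOrderedPair_iff]
  constructor
  · rintro ⟨x, rfl⟩
    exact ⟨_, ⟨x.1, rfl⟩, _, ⟨x.2, rfl⟩, rfl⟩
  · rintro ⟨_, ⟨a, rfl⟩, _, ⟨b, rfl⟩, rfl⟩
    exact ⟨(a, b), rfl⟩

theorem isIseq_iseq : IsIseq (iseq G) (atoms G) := by
  refine ⟨isSet_mk, fun s => ?_⟩
  simp only [iseq, mem_mk, isNatural_iff]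
  constructor
  · rintro ⟨l, rfl⟩
    exact ⟨_, ⟨_, rfl⟩, isInjection_seq_iff.2 ⟨l.1, l.2, rfl, rfl⟩⟩
  · rintro ⟨_, ⟨n, rfl⟩, h⟩
    obtain ⟨l, hl, _, rfl⟩ := isInjection_seq_iff.1 h
    exact ⟨⟨l, hl⟩, rfl⟩

theorem isTwoSubsets_twoSubsets : IsTwoSubsets (twoSubsets G) (atoms G) := by
  refine ⟨isSet_mk, fun z => ?_⟩
  simp only [twoSubsets, mem_mk, mem_atoms, isUnorderedPair_iff]
  constructor
  · rintro ⟨x, rfl⟩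
    exact ⟨_, ⟨x.1.1, rfl⟩, _, ⟨x.1.2, rfl⟩, by simpa using x.2, rfl⟩
  · rintro ⟨_, ⟨a, rfl⟩, _, ⟨b, rfl⟩, hab, rfl⟩
    exact ⟨⟨(a, b), by simpa using hab⟩, rfl⟩

theorem isFin_finiteSubsets : IsFin (finiteSubsets G) (atoms G) :=
  ⟨isSet_mk, fun z => by rw [isFinite_subset_atoms_iff, finiteSubsets, mem_mk]⟩

/-- The diagonal goes to sequences of length one, since `[a, a]` has a repetition. -/
theorem cardLE_square_iseq : CardLE (square G) (iseq G) := by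
  classical
  let g : A × A → List A := fun x => if x.1 = x.2 then [x.1] else [x.1, x.2]
  have hg : ∀ x, (g x).Nodup := fun x => by
    by_cases h : x.1 = x.2 <;> simp [g, h]
  obtain ⟨f, hf, _⟩ := exists_injection (ι := A × A) (X := square G) (Y := iseq G)
    (fun x => opair (atom x.1) (atom x.2)) (fun x => seq (g x)) (fun z => mem_mk)
    (fun x => mem_mk.2 ⟨⟨g x, hg x⟩, rfl⟩)
    (fun x y => by
      rw [opair_inj, seq_injective.eq_iff, atom_inj, atom_inj]
      by_cases h : x.1 = x.2 <;> by_cases h' : y.1 = y.2 <;> simp [g, h, h'] <;> grind)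
    ∅ (fun π _ x => ⟨(π.1 x.1, π.1 x.2), by simp, by
      by_cases h : x.1 = x.2 <;> simp [g, h]⟩)
  exact ⟨f, hf⟩

theorem cardLE_twoSubsets_finiteSubsets : CardLE (twoSubsets G) (finiteSubsets G) := by
  classical
  obtain ⟨f, hf, _⟩ := exists_injection (ι := {x : A × A // x.1 ≠ x.2})
    (X := twoSubsets G) (Y := finiteSubsets G)
    (fun x => upair (atom x.1.1) (atom x.1.2)) (fun x => upair (atom x.1.1) (atom x.1.2))
    (fun z => mem_mk) (fun x => mem_mk.2 ⟨{x.1.1, x.1.2}, upair_atom_eq_ofFinset _ _⟩)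
    (fun _ _ => Iff.rfl)
    ∅ (fun π _ x => ⟨⟨(π.1 x.1.1, π.1 x.1.2), by simpa using x.2⟩, by simp, by simp⟩)
  exact ⟨f, hf⟩

end PermutationModel

end ZFA

/-! ### The group `G`: construction of its elements and closed supports. -/

namespace ReflectedN

variable {A₀ : Type u}

theorem level_mono : Monotone (level A₀) := monotone_nat_of_le_succ fun _ => Set.subset_union_left

/-- The map on expressions given by a map of the base elements and by the numbers that are added to
the last components of the triples. -/
def Expr.lift (π : A₀ → A₀) (e : ℕ → List (Expr A₀) → ZMod 2) : Expr A₀ → Expr A₀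
  | .base a => .base (π a)
  | .triple n p ε => .triple n (p.map (lift π e)) (e n p + ε)

/-- The inverse of `Expr.lift`. -/
def Expr.unlift (π : A₀ → A₀) (e : ℕ → List (Expr A₀) → ZMod 2) : Expr A₀ → Expr A₀
  | .base a => .base (π a)
  -- The label shift is attached to the source sequence, hence is evaluated at the preimage of `p`;
  -- modulo 2 adding it again undoes it.
  | .triple n p ε => .triple n (p.map (unlift π e)) (e n (p.map (unlift π e)) + ε)

@[elab_as_elim]
theorem Expr.induction_list {P : Expr A₀ → Prop} (base : ∀ a, P (.base a))
    (triple : ∀ n p ε, (∀ y ∈ p, P y) → P (.triple n p ε)) : ∀ x, P x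
  | .base a => base a
  | .triple n p ε => triple n p ε fun y _ => induction_list base triple y

theorem Expr.unlift_lift {π ρ : A₀ → A₀} (h : Function.LeftInverse ρ π)
    (e : ℕ → List (Expr A₀) → ZMod 2) (x : Expr A₀) : unlift ρ e (lift π e x) = x := by
  induction x using Expr.induction_list with
  | base a => simp [lift, unlift, h a]
  | triple n p ε ih =>
    have : p.map (unlift ρ e ∘ lift π e) = p := by
      conv_rhs => rw [← List.map_id p]
      exact List.map_congr_left ih
    simp [lift, unlift, this, ← add_assoc, CharTwo.add_self_eq_zero]

theorem Expr.lift_unlift {π ρ : A₀ → A₀} (h : Function.LeftInverse π ρ)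
    (e : ℕ → List (Expr A₀) → ZMod 2) (x : Expr A₀) : lift π e (unlift ρ e x) = x := by
  induction x using Expr.induction_list with
  | base a => simp [lift, unlift, h a]
  | triple n p ε ih =>
    have : p.map (lift π e ∘ unlift ρ e) = p := by
      conv_rhs => rw [← List.map_id p]
      exact List.map_congr_left ih
    simp [lift, unlift, this, ← add_assoc, CharTwo.add_self_eq_zero]

theorem Expr.lift_mem_level (π : A₀ → A₀) (e : ℕ → List (Expr A₀) → ZMod 2) {n : ℕ}
    {x : Expr A₀} (hx : x ∈ level A₀ n) : lift π e x ∈ level A₀ n := by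
  induction n generalizing x with
  | zero =>
    obtain ⟨a, rfl⟩ := hx
    exact ⟨π a, by simp [lift]⟩
  | succ n ih =>
    obtain hx | ⟨p, hp, hl, ε, rfl⟩ := hx
    · exact Or.inl (ih hx)
    · exact Or.inr ⟨p.map (lift π e), by simpa using fun y hy => ih (hp y hy), by simpa using hl,
        _, by rw [lift]⟩

theorem Expr.unlift_mem_level (π : A₀ → A₀) (e : ℕ → List (Expr A₀) → ZMod 2) {n : ℕ}
    {x : Expr A₀} (hx : x ∈ level A₀ n) : unlift π e x ∈ level A₀ n := by
  induction n generalizing x with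
  | zero =>
    obtain ⟨a, rfl⟩ := hx
    exact ⟨π a, by simp [unlift]⟩
  | succ n ih =>
    obtain hx | ⟨p, hp, hl, ε, rfl⟩ := hx
    · exact Or.inl (ih hx)
    · exact Or.inr ⟨p.map (unlift π e), by simpa using fun y hy => ih (hp y hy), by simpa using hl,
        _, by rw [unlift]⟩

/-- The permutation of `A_n` given by a permutation of `A₀` and the numbers `e n p`. -/
def levelLift (π : Equiv.Perm A₀) (e : ℕ → List (Expr A₀) → ZMod 2) (n : ℕ) :
    Equiv.Perm (level A₀ n) where
  toFun x := ⟨Expr.lift π e x.1, Expr.lift_mem_level _ _ x.2⟩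
  invFun x := ⟨Expr.unlift π.symm e x.1, Expr.unlift_mem_level _ _ x.2⟩
  left_inv x := Subtype.ext (Expr.unlift_lift π.left_inv e x.1)
  right_inv x := Subtype.ext (Expr.lift_unlift π.right_inv e x.1)

theorem levelLift_mem (π : Equiv.Perm A₀) (e : ℕ → List (Expr A₀) → ZMod 2) (n : ℕ) :
    levelLift π e n ∈ levelGroup n := by
  induction n with
  | zero => exact Subgroup.mem_top _
  | succ n ih =>
    refine ⟨levelLift π e n, ih, fun p => e (n + 1) (p.map Subtype.val), fun _ => rfl,
      fun p hp ε => Subtype.ext ?_⟩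
    simp [levelLift, new, Expr.lift]

/-- The element of the group given by a permutation of `A₀` and the numbers `e n p`. -/
def groupLift (π : Equiv.Perm A₀) (e : ℕ → List (Expr A₀) → ZMod 2) : group A₀ :=
  ⟨{ toFun := fun x => ⟨Expr.lift π e x.1, x.2.imp fun _ => Expr.lift_mem_level _ _⟩
     invFun := fun x => ⟨Expr.unlift π.symm e x.1, x.2.imp fun _ => Expr.unlift_mem_level _ _⟩
     left_inv := fun x => Subtype.ext (Expr.unlift_lift π.left_inv e x.1)
     right_inv := fun x => Subtype.ext (Expr.lift_unlift π.right_inv e x.1) },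
    fun n => ⟨levelLift π e n, levelLift_mem π e n, fun _ => rfl⟩⟩

/-- The expression that an atom is. -/
def Atom.expr (x : Atom A₀) : Expr A₀ := x.1

theorem Atom.expr_injective : Function.Injective (Atom.expr : Atom A₀ → Expr A₀) :=
  Subtype.val_injective

theorem exists_eq_map_expr {n : ℕ} {p : List (Expr A₀)} (hp : ∀ y ∈ p, y ∈ level A₀ n) :
    ∃ q : List (Atom A₀), p = q.map Atom.expr := by
  let g : {y // y ∈ p} → Atom A₀ := fun y => ⟨y.1, n, hp y.1 y.2⟩
  refine ⟨p.attach.map g, ?_⟩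
  rw [List.map_map]
  exact p.attach_map_subtype_val.symm

/-- The element `a` of `A₀` as an atom. -/
def baseAtom (a : A₀) : Atom A₀ := ⟨.base a, 0, a, rfl⟩

theorem Atom.expr_baseAtom (a : A₀) : (baseAtom a).expr = .base a := rfl

theorem baseAtom_injective : Function.Injective (baseAtom : A₀ → Atom A₀) := fun a b h => by
  have h' := congrArg Atom.expr h
  rw [Atom.expr_baseAtom, Atom.expr_baseAtom] at h'
  exact Expr.base.inj h'

/-- `p` is a sequence in `A_n` of length at most `n+1`. -/
def IsIndex (n : ℕ) (p : List (Atom A₀)) : Prop :=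
  (∀ y ∈ p, y.1 ∈ level A₀ n) ∧ p.length ≤ n + 1

/-- The atom `(n+1, p, ε)`. -/
def tripleAtom (n : ℕ) (p : List (Atom A₀)) (hp : IsIndex n p) (ε : ZMod 2) : Atom A₀ :=
  ⟨.triple (n + 1) (p.map Atom.expr) ε, n + 1, Or.inr ⟨p.map Atom.expr,
    fun y hy => by
      obtain ⟨z, hz, rfl⟩ := List.mem_map.1 hy
      exact hp.1 z hz,
    by rw [List.length_map]; exact hp.2, ε, rfl⟩⟩

theorem Atom.expr_tripleAtom (n : ℕ) (p : List (Atom A₀)) (hp : IsIndex n p) (ε : ZMod 2) :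
    (tripleAtom n p hp ε).expr = .triple (n + 1) (p.map Atom.expr) ε := rfl

theorem tripleAtom_inj {n m : ℕ} {p q : List (Atom A₀)} {hp : IsIndex n p} {hq : IsIndex m q}
    {ε δ : ZMod 2} : tripleAtom n p hp ε = tripleAtom m q hq δ ↔ n = m ∧ p = q ∧ ε = δ := by
  rw [← Atom.expr_injective.eq_iff, Atom.expr_tripleAtom, Atom.expr_tripleAtom,
    Expr.triple.injEq, (List.map_injective_iff.2 Atom.expr_injective).eq_iff,
    Nat.add_right_cancel_iff]

theorem baseAtom_ne_tripleAtom {a : A₀} {n : ℕ} {p : List (Atom A₀)} {hp : IsIndex n p}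
    {ε : ZMod 2} : baseAtom a ≠ tripleAtom n p hp ε := fun h => by
  have h' := congrArg Atom.expr h
  rw [Atom.expr_baseAtom, Atom.expr_tripleAtom] at h'
  cases h'

/-- Induction on the construction of the atoms. -/
@[elab_as_elim]
theorem Atom.induction {P : Atom A₀ → Prop} (base : ∀ a, P (baseAtom a))
    (triple : ∀ n p hp ε, (∀ y ∈ p, P y) → P (tripleAtom n p hp ε)) (x : Atom A₀) : P x := by
  obtain ⟨x, n, hx⟩ := x
  induction n generalizing x with
  | zero =>
    obtain ⟨a, rfl⟩ := hx
    exact base a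
  | succ n ih =>
    by_cases hx' : x ∈ level A₀ n
    · exact ih x hx'
    · obtain ⟨p, hp, hl, ε, rfl⟩ := hx.resolve_left hx'
      obtain ⟨p, rfl⟩ := exists_eq_map_expr hp
      exact triple n p ⟨fun y hy => hp _ (List.mem_map_of_mem hy), by simpa using hl⟩ ε
        fun y hy => ih y.1 (hp _ (List.mem_map_of_mem hy))

theorem level_of_mem_group {H : Equiv.Perm (Atom A₀)} (hH : H ∈ group A₀) {n : ℕ} {x : Atom A₀}
    (hx : x.1 ∈ level A₀ n) : (H x).1 ∈ level A₀ n := by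
  obtain ⟨σ, _, h⟩ := hH n
  have := h ⟨x.1, hx⟩
  have e : toAtom (⟨x.1, hx⟩ : level A₀ n) = x := rfl
  rw [← e, this]
  exact (σ _).2

theorem IsIndex.map {n : ℕ} {p : List (Atom A₀)} (hp : IsIndex n p) (H : group A₀) :
    IsIndex n (p.map H.1) :=
  ⟨by simpa using fun y hy => level_of_mem_group H.2 (hp.1 y hy), by simpa using hp.2⟩

theorem isIndex_map_iff {n : ℕ} {p : List (Atom A₀)} (H : group A₀) :
    IsIndex n (p.map H.1) ↔ IsIndex n p :=
  ⟨fun h => by simpa [Function.comp_def] using h.map H⁻¹, fun h => h.map H⟩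

/-- The defining property of the groups `G_n`, transferred to atoms. The shift `δ` does not depend
on `ε`, so twins remain twins. -/
theorem group_apply_tripleAtom (H : group A₀) (n : ℕ) (p : List (Atom A₀)) (hp : IsIndex n p) :
    ∃ δ : ZMod 2, ∀ ε, H.1 (tripleAtom n p hp ε) = tripleAtom n (p.map H.1) (hp.map H) (δ + ε) := by
  obtain ⟨σ, ⟨π, _, e, h1, h2⟩, h⟩ := H.2 (n + 1)
  obtain ⟨q, rfl⟩ : ∃ q : List (level A₀ n), p = q.map toAtom := by
    refine ⟨p.attach.map fun y => ⟨y.1.1, hp.1 y.1 y.2⟩, ?_⟩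
    rw [List.map_map]
    exact p.attach_map_subtype_val.symm
  have hq : q.length ≤ n + 1 := by simpa using hp.2
  have hπ : ∀ x, H.1 (toAtom x) = toAtom (π x) := fun x => by
    have := h (incl x)
    rw [h1] at this
    exact this
  refine ⟨e q, fun ε => ?_⟩
  have key : ∀ (r : List (level A₀ n)) (hr : IsIndex n (r.map toAtom)) (hr' : r.length ≤ n + 1)
      (ε : ZMod 2), toAtom (new r hr' ε) = tripleAtom n (r.map toAtom) hr ε := by
    intro r hr hr' ε
    refine Atom.expr_injective ?_
    rw [Atom.expr_tripleAtom, List.map_map]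
    rfl
  have hmap : (q.map toAtom).map H.1 = (q.map π).map toAtom := by
    simp [Function.comp_def, hπ]
  rw [← key q hp hq, h, h2, key _ (hmap ▸ hp.map H), tripleAtom_inj]
  exact ⟨rfl, hmap.symm, rfl⟩

theorem expr_groupLift (π : Equiv.Perm A₀) (e : ℕ → List (Expr A₀) → ZMod 2) (x : Atom A₀) :
    ((groupLift π e).1 x).expr = x.expr.lift π e := rfl

theorem groupLift_baseAtom (π : Equiv.Perm A₀) (e : ℕ → List (Expr A₀) → ZMod 2) (a : A₀) :
    (groupLift π e).1 (baseAtom a) = baseAtom (π a) := by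
  refine Atom.expr_injective ?_
  rw [expr_groupLift, Atom.expr_baseAtom, Atom.expr_baseAtom, Expr.lift]

theorem groupLift_tripleAtom (π : Equiv.Perm A₀) (e : ℕ → List (Expr A₀) → ZMod 2) (n : ℕ)
    (p : List (Atom A₀)) (hp : IsIndex n p) (ε : ZMod 2) :
    (groupLift π e).1 (tripleAtom n p hp ε) =
      tripleAtom n (p.map (groupLift π e).1) (hp.map _) (e (n + 1) (p.map Atom.expr) + ε) := by
  refine Atom.expr_injective ?_
  rw [expr_groupLift, Atom.expr_tripleAtom, Atom.expr_tripleAtom, Expr.lift, List.map_map,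
    List.map_map]
  rfl

/-- A set of atoms that contains with `(n+1, p, ε)` also `(n+1, p, 1-ε)` and the entries of `p`. -/
def IsClosedSet (F : Set (Atom A₀)) : Prop :=
  ∀ n p hp ε, tripleAtom n p hp ε ∈ F → (∀ δ, tripleAtom n p hp δ ∈ F) ∧ ∀ y ∈ p, y ∈ F

theorem IsClosedSet.biUnion {ι : Type*} {s : Set ι} {F : ι → Set (Atom A₀)}
    (h : ∀ i ∈ s, IsClosedSet (F i)) : IsClosedSet (⋃ i ∈ s, F i) := by
  intro n p hp ε hm
  obtain ⟨i, hi, hm⟩ := Set.mem_iUnion₂.1 hm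
  obtain ⟨h1, h2⟩ := h i hi n p hp ε hm
  exact ⟨fun δ => Set.mem_biUnion hi (h1 δ), fun y hy => Set.mem_biUnion hi (h2 y hy)⟩

/-- An atom is built from finitely many others in finitely many stages, and each index sequence
carries just two labels. -/
theorem exists_finite_isClosedSet_mem (x : Atom A₀) :
    ∃ F : Set (Atom A₀), F.Finite ∧ IsClosedSet F ∧ x ∈ F := by
  induction x using Atom.induction with
  | base a =>
    refine ⟨{baseAtom a}, Set.finite_singleton _, fun n p hp ε h => ?_, rfl⟩
    exact (baseAtom_ne_tripleAtom (Set.mem_singleton_iff.1 h).symm).elim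
  | triple n p hp ε ih =>
    choose! F hfin hcl hmem using ih
    refine ⟨Set.range (tripleAtom n p hp) ∪ ⋃ y ∈ {y | y ∈ p}, F y,
      (Set.finite_range _).union (p.finite_toSet.biUnion hfin), fun m q hq δ h => ?_,
      Or.inl ⟨ε, rfl⟩⟩
    obtain ⟨ε', h⟩ | h := h
    · obtain ⟨rfl, rfl, _⟩ := tripleAtom_inj.1 h
      exact ⟨fun δ => Or.inl ⟨δ, rfl⟩, fun y hy => Or.inr (Set.mem_biUnion hy (hmem y hy))⟩
    · obtain ⟨h1, h2⟩ := IsClosedSet.biUnion hcl m q hq δ h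
      exact ⟨fun δ => Or.inr (h1 δ), fun y hy => Or.inr (h2 y hy)⟩

theorem exists_isClosedSet_superset (E : Finset (Atom A₀)) :
    ∃ F : Finset (Atom A₀), IsClosedSet (F : Set (Atom A₀)) ∧ E ⊆ F := by
  choose F hfin hcl hmem using exists_finite_isClosedSet_mem (A₀ := A₀)
  have h : (⋃ x ∈ (E : Set (Atom A₀)), F x).Finite := E.finite_toSet.biUnion fun x _ => hfin x
  refine ⟨h.toFinset, ?_, fun x hx => ?_⟩
  · rw [h.coe_toFinset]
    exact IsClosedSet.biUnion fun x _ => hcl x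
  · rw [h.mem_toFinset]
    exact Set.mem_biUnion hx (hmem x)

/-- Closedness is what makes the induction on atoms stay inside `F`; it also lets the label 0 alone
stand for both twins in `he`. -/
theorem groupLift_fixes {F : Set (Atom A₀)} (hF : IsClosedSet F) {π : Equiv.Perm A₀}
    {e : ℕ → List (Expr A₀) → ZMod 2} (hπ : ∀ a, baseAtom a ∈ F → π a = a)
    (he : ∀ n p hp, tripleAtom n p hp 0 ∈ F → e (n + 1) (p.map Atom.expr) = 0) {x : Atom A₀}
    (hx : x ∈ F) : (groupLift π e).1 x = x := by
  induction x using Atom.induction with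
  | base a => rw [groupLift_baseAtom, hπ a hx]
  | triple n p hp ε ih =>
    obtain ⟨h1, h2⟩ := hF n p hp ε hx
    rw [groupLift_tripleAtom, tripleAtom_inj, he n p hp (h1 0)]
    refine ⟨rfl, ?_, zero_add _⟩
    conv_rhs => rw [← List.map_id p]
    exact List.map_congr_left fun y hy => ih y hy (h2 y hy)

/-- A pair of triples outside a closed set can be interchanged while the closed set is fixed. -/
theorem exists_flip {F : Set (Atom A₀)} (hF : IsClosedSet F) {n : ℕ} {p : List (Atom A₀)}
    {hp : IsIndex n p} {ε : ZMod 2} (hx : tripleAtom n p hp ε ∉ F) :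
    ∃ H : group A₀, (∀ y ∈ F, H.1 y = y) ∧
      H.1 (tripleAtom n p hp ε) = tripleAtom n p hp (1 + ε) := by
  classical
  let e : ℕ → List (Expr A₀) → ZMod 2 := fun m q =>
    if m = n + 1 ∧ q = p.map Atom.expr then 1 else 0
  -- The shift `e` is nonzero only at the index `(n+1, p)`, so nothing in `A_n` moves. In particular
  -- the entries of `p` stay fixed, and the flipped triple keeps its index.
  have hlow : ∀ m, ∀ y : Atom A₀, y.1 ∈ level A₀ m → m ≤ n → (groupLift 1 e).1 y = y := by
    intro m
    induction m with
    | zero =>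
      rintro ⟨_, hy'⟩ ⟨a, rfl⟩ _
      exact groupLift_baseAtom 1 e a
    | succ m ih =>
      rintro ⟨y, hy'⟩ hy hm
      by_cases hy2 : y ∈ level A₀ m
      · exact ih ⟨y, hy'⟩ hy2 (by omega)
      · obtain ⟨q, hq, hl, ε, rfl⟩ := hy.resolve_left hy2
        obtain ⟨q, rfl⟩ := exists_eq_map_expr hq
        have hq' : IsIndex m q :=
          ⟨fun y hy => hq _ (List.mem_map_of_mem hy), by simpa using hl⟩
        refine (groupLift_tripleAtom 1 e m q hq' ε).trans 
          ((tripleAtom_inj (hq := hq')).2 ⟨rfl, ?_, ?_⟩)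
        · conv_rhs => rw [← List.map_id q]
          exact List.map_congr_left fun y hy => ih y (hq'.1 y hy) (by omega)
        · simp [e, show m ≠ n by omega]
  refine ⟨groupLift 1 e, fun y hy => groupLift_fixes hF (fun _ _ => rfl) ?_ hy, ?_⟩
  -- If a triple of `F` had the index `(n+1, p)`, closedness would put the triple to be flipped into
  -- `F`.
  · intro m q hq hm
    refine if_neg fun h => hx ?_
    obtain ⟨h1, h2⟩ := h
    obtain rfl : m = n := by omega
    obtain rfl := List.map_injective_iff.2 Atom.expr_injective h2
    exact (hF _ _ _ _ hm).1 ε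
  · rw [groupLift_tripleAtom, tripleAtom_inj]
    refine ⟨rfl, ?_, by simp [e]⟩
    conv_rhs => rw [← List.map_id p]
    exact List.map_congr_left fun y hy => hlow n y (hp.1 y hy) le_rfl

/-- A base atom outside a closed set can be moved to any other one while the closed set is
fixed. -/
theorem exists_swap {F : Set (Atom A₀)} (hF : IsClosedSet F) {a b : A₀} (ha : baseAtom a ∉ F)
    (hb : baseAtom b ∉ F) :
    ∃ H : group A₀, (∀ y ∈ F, H.1 y = y) ∧ H.1 (baseAtom a) = baseAtom b ∧
      H.1 (baseAtom b) = baseAtom a ∧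
      ∀ c, c ≠ a → c ≠ b → H.1 (baseAtom c) = baseAtom c := by
  classical
  refine ⟨groupLift (Equiv.swap a b) 0, fun y hy => groupLift_fixes hF ?_ (fun _ _ _ _ => rfl) hy,
    ?_, ?_, fun c hca hcb => ?_⟩
  · intro c hc
    exact Equiv.swap_apply_of_ne_of_ne (fun h => ha (h ▸ hc)) (fun h => hb (h ▸ hc))
  · rw [groupLift_baseAtom, Equiv.swap_apply_left]
  · rw [groupLift_baseAtom, Equiv.swap_apply_right]
  · rw [groupLift_baseAtom, Equiv.swap_apply_of_ne_of_ne hca hcb]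

theorem exists_baseAtom_notMem [Infinite A₀] (F : Finset (Atom A₀)) : ∃ a, baseAtom a ∉ F := by
  obtain ⟨a, ha⟩ := (F.finite_toSet.preimage (f := baseAtom)
    baseAtom_injective.injOn).exists_notMem
  exact ⟨a, ha⟩

/-- A base atom outside `F` can be swapped with a second one, which exists as `A₀` is infinite; a
triple outside `F` can be flipped. -/
theorem mem_of_fixed [Infinite A₀] {F : Finset (Atom A₀)} (hF : IsClosedSet (F : Set (Atom A₀)))
    {x : Atom A₀} (hx : ∀ H : group A₀, (∀ y ∈ F, H.1 y = y) → H.1 x = x) : x ∈ F := by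
  classical
  by_contra hxF
  cases x using Atom.induction with
  | base a =>
    obtain ⟨b, hb⟩ := exists_baseAtom_notMem (insert (baseAtom a) F)
    rw [Finset.mem_insert, not_or] at hb
    obtain ⟨H, h1, h2, _⟩ := exists_swap hF hxF hb.2
    exact hb.1 (h2.symm.trans (hx H h1))
  | triple n p hp ε _ =>
    obtain ⟨H, h1, h2⟩ := exists_flip hF hxF
    have := (tripleAtom_inj.1 (h2.symm.trans (hx H h1))).2.2
    simp at this

end ReflectedN

/-! ### The three inequalities. -/

namespace ReflectedN

open ZFA ZFA.PermutationModel

variable {A₀ : Type u}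

theorem exists_isIndex (l : List (Atom A₀)) : ∃ n, IsIndex n l := by
  induction l with
  | nil => exact ⟨0, by simp [IsIndex]⟩
  | cons x l ih =>
    obtain ⟨n, h1, h2⟩ := ih
    obtain ⟨m, hm⟩ := x.2
    -- The new head needs level `m`, and the length grows by one.
    refine ⟨max (n + 1) m, ?_, by simp; omega⟩
    rintro y (_ | ⟨_, hy⟩)
    · exact level_mono (le_max_right _ _) hm
    · exact level_mono ((Nat.le_succ n).trans (le_max_left _ _)) (h1 y hy)

/-- The set `{(n+1, p, 0), (n+1, p, 1)}`. -/
noncomputable def twins (n : ℕ) (p : List (Atom A₀)) (hp : IsIndex n p) : Model A₀ :=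
  upair (atom (tripleAtom n p hp 0)) (atom (tripleAtom n p hp 1))

theorem upair_tripleAtom (n : ℕ) (p : List (Atom A₀)) (hp : IsIndex n p) (ε : ZMod 2) :
    (upair (atom (tripleAtom n p hp ε)) (atom (tripleAtom n p hp (1 + ε))) : Model A₀) =
      twins n p hp := by
  rw [twins, upair_inj]
  simp only [atom_inj, tripleAtom_inj, true_and]
  revert ε
  decide

/-- Passing to the unordered pair forgets the shift `δ`; this makes the coding of sequences by twins
commute with `G`. -/
theorem act_twins (H : group A₀) (n : ℕ) (p : List (Atom A₀)) (hp : IsIndex n p) :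
    act H (twins n p hp) = twins n (p.map H.1) (hp.map H) := by
  obtain ⟨δ, hδ⟩ := group_apply_tripleAtom H n p hp
  rw [twins, act_upair, act_atom, act_atom, hδ, hδ, ← upair_tripleAtom _ _ _ δ, add_zero,
    add_comm δ 1]

theorem twins_inj {n m : ℕ} {p q : List (Atom A₀)} {hp : IsIndex n p} {hq : IsIndex m q} :
    twins n p hp = twins m q hq ↔ n = m ∧ p = q := by
  simp only [twins, upair_inj, atom_inj, tripleAtom_inj]
  grind

theorem twins_mem (n : ℕ) (p : List (Atom A₀)) (hp : IsIndex n p) :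
    twins n p hp ∈ twoSubsets (group A₀) :=
  mem_mk.2 ⟨⟨(tripleAtom n p hp 0, tripleAtom n p hp 1), by simp [tripleAtom_inj]⟩, rfl⟩

/-- A sequence has twins at many levels; the least possible `n` is a canonical choice, invariant
because `G` preserves every `A_n`. -/
theorem cardLE_iseq_twoSubsets : CardLE (iseq (group A₀)) (twoSubsets (group A₀)) := by
  classical
  let N : List (Atom A₀) → ℕ := fun l => Nat.find (exists_isIndex l)
  have hN : ∀ l, IsIndex (N l) l := fun l => Nat.find_spec (exists_isIndex l)
  have hmap : ∀ (H : group A₀) l, N (l.map H.1) = N l := fun H l => by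
    simp only [N, isIndex_map_iff]
  obtain ⟨f, hf, _⟩ := exists_injection (ι := {l : List (Atom A₀) // l.Nodup})
    (X := iseq (group A₀)) (Y := twoSubsets (group A₀))
    (fun l => seq l.1) (fun l => twins (N l.1) l.1 (hN l.1)) (fun z => mem_mk)
    (fun l => twins_mem _ _ _)
    (fun l l' => by
      rw [seq_injective.eq_iff, twins_inj]
      exact ⟨fun h => ⟨by rw [h], h⟩, fun h => h.2⟩)
    ∅ (fun H _ l => ⟨⟨l.1.map H.1, l.2.map H.1.injective⟩, by simp, by
      rw [act_twins, twins_inj]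
      exact ⟨(hmap H l.1).symm, rfl⟩⟩)
  exact ⟨f, hf⟩

theorem exists_isClosedSet_support (f : Model A₀) :
    ∃ F : Finset (Atom A₀), IsClosedSet (F : Set (Atom A₀)) ∧
      ∀ H : group A₀, (∀ y ∈ F, H.1 y = y) → act H f = f := by
  obtain ⟨E, hE⟩ := exists_support f
  obtain ⟨F, hF, hEF⟩ := exists_isClosedSet_superset E
  exact ⟨F, hF, fun H h => hE H fun a ha => h a (hEF ha)⟩

/-- `H` sends the pair `(x, y)` of `f` to another pair of `f`, and in an injection each coordinate
determines the other. -/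
theorem act_eq_of_maps {f X Y x y : Model A₀} (hf : IsInjection f X Y) (h : Maps f x y)
    {H : group A₀} (hHf : act H f = f) : act H x = x ↔ act H y = y := by
  have h' := maps_act H h
  rw [hHf] at h'
  constructor
  · intro hx
    rw [hx] at h'
    exact hf.1.maps_unique h' h
  · intro hy
    rw [hy] at h'
    exact hf.2 _ _ _ h' h

theorem map_eq_self {H : Atom A₀ → Atom A₀} {l : List (Atom A₀)} :
    l.map H = l ↔ ∀ y ∈ l, H y = y := by
  conv_lhs => rhs; rw [← List.map_id l]
  exact List.map_inj_left

/-- The elements of the group that fix `F` pointwise and `X` setwise. -/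
def StabilizesOver (F : Finset (Atom A₀)) (X : Finset A₀) (H : group A₀) : Prop :=
  (∀ y ∈ F, H.1 y = y) ∧ ∀ a ∈ X, ∃ b ∈ X, H.1 (baseAtom a) = baseAtom b

theorem exists_stabilizesOver_swap {F : Finset (Atom A₀)} (hF : IsClosedSet (F : Set (Atom A₀)))
    {X : Finset A₀} {a b : A₀} (ha : baseAtom a ∉ F) (hb : baseAtom b ∉ F) (hab : a ∈ X ↔ b ∈ X) :
    ∃ H, StabilizesOver F X H ∧ H.1 (baseAtom a) = baseAtom b := by
  obtain ⟨H, h1, h2, h3, h4⟩ := exists_swap hF ha hb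
  refine ⟨H, ⟨h1, fun c hc => ?_⟩, h2⟩
  by_cases hca : c = a
  · subst hca
    exact ⟨b, hab.1 hc, h2⟩
  by_cases hcb : c = b
  · subst hcb
    exact ⟨a, hab.2 hc, h3⟩
  exact ⟨c, hc, h4 c hca hcb⟩

variable [Infinite A₀]

theorem not_cardEq_square_iseq : ¬ CardEq (square (group A₀)) (iseq (group A₀)) := by
  classical
  rintro ⟨f, hf, hsurj⟩
  obtain ⟨F, hF, hfix⟩ := exists_isClosedSet_support f
  have key : ∀ l : List (Atom A₀), l.Nodup → (∀ y ∈ l, y ∈ F) →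
      ∃ x : F × F, Maps f (opair (atom x.1.1) (atom x.2.1)) (seq l) := by
    intro l hl hlF
    obtain ⟨x, hx⟩ := hsurj (seq l) (mem_mk.2 ⟨⟨l, hl⟩, rfl⟩)
    obtain ⟨⟨a, b⟩, rfl⟩ := mem_mk.1 (hf.1.mem_of_maps hx).1
    have h : ∀ H : group A₀, (∀ y ∈ F, H.1 y = y) → H.1 a = a ∧ H.1 b = b := fun H hH => by
      have := (act_eq_of_maps hf hx (hfix H hH)).2 (by
        rw [act_seq, map_eq_self.2 fun y hy => hH y (hlF y hy)])
      simpa [opair_inj] using this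
    exact ⟨(⟨a, mem_of_fixed hF fun H hH => (h H hH).1⟩,
      ⟨b, mem_of_fixed hF fun H hH => (h H hH).2⟩), hx⟩
  -- These are the `|F|² + 1` repetition-free sequences of length at most two over `F`: the empty
  -- one for `none`, the singletons for the diagonal.
  let g : Option (F × F) → List (Atom A₀) := fun o =>
    o.elim [] fun x => if x.1 = x.2 then [x.1.1] else [x.1.1, x.2.1]
  have hg : Function.Injective g := by
    rintro (_ | x) (_ | y) h
    · rfl
    · by_cases h1 : y.1 = y.2 <;> simp [g, h1] at h
    · by_cases h1 : x.1 = x.2 <;> simp [g, h1] at h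
    · by_cases h1 : x.1 = x.2 <;> by_cases h2 : y.1 = y.2 <;> simp [g, h1, h2] at h <;> grind
  have hg' : ∀ o, ∃ x : F × F, Maps f (opair (atom x.1.1) (atom x.2.1)) (seq (g o)) := by
    intro o
    refine key _ ?_ ?_
    · rcases o with _ | x
      · simp [g]
      · by_cases h : x.1 = x.2
        · simp [g, h]
        · have h' : x.1.1 ≠ x.2.1 := fun e => h (Subtype.ext e)
          simp [g, h, h']
    · rcases o with _ | x
      · simp [g]
      · by_cases h : x.1 = x.2 <;> simp [g, h]
  choose k hk using hg'
  have hk' : Function.Injective k := fun o o' h =>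
    hg (seq_injective (hf.1.maps_unique (hk o) (h ▸ hk o')))
  have := Fintype.card_le_of_injective k hk'
  simp at this

theorem not_cardEq_iseq_twoSubsets : ¬ CardEq (iseq (group A₀)) (twoSubsets (group A₀)) := by
  classical
  rintro ⟨f, hf, hsurj⟩
  obtain ⟨F, hF, hfix⟩ := exists_isClosedSet_support f
  -- The empty sequence is an index at every level, and its twins are invariant under all of `G`.
  have key : ∀ n : ℕ, ∃ l : {l : List F // l.Nodup},
      Maps f (seq (l.1.map Subtype.val)) (twins n [] (by simp [IsIndex])) := by
    intro n
    obtain ⟨x, hx⟩ := hsurj _ (twins_mem n [] (by simp [IsIndex]))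
    obtain ⟨⟨l, hl⟩, rfl⟩ := mem_mk.1 (hf.1.mem_of_maps hx).1
    have h : ∀ y ∈ l, y ∈ F := fun y hy => mem_of_fixed hF fun H hH => by
      have := (act_eq_of_maps hf hx (hfix H hH)).2 (act_twins H n [] _)
      rw [act_seq, seq_injective.eq_iff, map_eq_self] at this
      exact this y hy
    lift l to List F using h
    exact ⟨⟨l, hl.of_map _⟩, hx⟩
  choose k hk using key
  refine not_injective_infinite_finite k fun n m h => ?_
  exact (twins_inj.1 (hf.1.maps_unique (hk n) (h ▸ hk m))).1

/-- An unordered pair of atoms that is invariant under the stabilizer of `X` over `F` and not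
contained in `F` consists of `(n+1, p, 0)` and `(n+1, p, 1)` with entries of `p` in `F`. -/
theorem exists_tripleAtom_of_stabilized {F : Finset (Atom A₀)}
    (hF : IsClosedSet (F : Set (Atom A₀))) {X : Finset A₀} (hX : ∀ a ∈ X, baseAtom a ∉ F)
    (hcard : 3 ≤ X.card) {x y : Atom A₀} (hx : x ∉ F)
    (h : ∀ H, StabilizesOver F X H → H.1 x = x ∨ H.1 x = y) :
    ∃ n p hp ε, x = tripleAtom n p hp ε ∧ y = tripleAtom n p hp (1 + ε) ∧ ∀ z ∈ p, z ∈ F := by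
  classical
  have hF' : IsClosedSet ((F ∪ X.image baseAtom : Finset (Atom A₀)) : Set (Atom A₀)) := by
    intro n p hp ε hm
    simp only [Finset.coe_union, Finset.coe_image] at hm ⊢
    obtain hm | ⟨a, _, ha⟩ := hm
    · obtain ⟨h1, h2⟩ := hF n p hp ε hm
      exact ⟨fun δ => Or.inl (h1 δ), fun y hy => Or.inl (h2 y hy)⟩
    · exact (baseAtom_ne_tripleAtom ha).elim
  have hstab : ∀ H : group A₀, (∀ z ∈ F ∪ X.image baseAtom, H.1 z = z) → StabilizesOver F X H :=
    fun H hH => ⟨fun z hz => hH z (Finset.mem_union_left _ hz), fun a ha =>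
      ⟨a, ha, hH _ (Finset.mem_union_right _ (Finset.mem_image_of_mem _ ha))⟩⟩
  cases x using Atom.induction with
  | base a =>
    exfalso
    -- A base atom outside `F` has at least three images under the stabilizer, while `h` leaves room
    -- for two. For `a ∈ X` this is where three elements of `X` are needed.
    obtain ⟨b, c, hb, hc, hba, hca, hbc, hab, hac⟩ : ∃ b c, baseAtom b ∉ F ∧ baseAtom c ∉ F ∧
        b ≠ a ∧ c ≠ a ∧ b ≠ c ∧ (a ∈ X ↔ b ∈ X) ∧ (a ∈ X ↔ c ∈ X) := by
      by_cases haX : a ∈ X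
      · obtain ⟨b, hb, c, hc, hbc⟩ := Finset.one_lt_card.1
          (show 1 < (X.erase a).card by rw [Finset.card_erase_of_mem haX]; omega)
        rw [Finset.mem_erase] at hb hc
        exact ⟨b, c, hX b hb.2, hX c hc.2, hb.1, hc.1, hbc, by simp [haX, hb.2],
          by simp [haX, hc.2]⟩
      · obtain ⟨b, hb⟩ := exists_baseAtom_notMem (F ∪ (insert a X).image baseAtom)
        obtain ⟨c, hc⟩ := exists_baseAtom_notMem (F ∪ (insert b (insert a X)).image baseAtom)
        simp only [Finset.mem_union, baseAtom_injective.mem_finset_image, Finset.mem_insert,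
          not_or] at hb hc
        exact ⟨b, c, hb.1, hc.1, hb.2.1, hc.2.2.1, Ne.symm hc.2.1, by simp [haX, hb.2.2],
          by simp [haX, hc.2.2.2]⟩
    obtain ⟨H, hH, e⟩ := exists_stabilizesOver_swap hF hx hb hab
    obtain ⟨H', hH', e'⟩ := exists_stabilizesOver_swap hF hx hc hac
    have h1 := h H hH
    have h2 := h H' hH'
    rw [e, baseAtom_injective.eq_iff] at h1
    rw [e', baseAtom_injective.eq_iff] at h2
    exact hbc (baseAtom_injective ((h1.resolve_left hba).trans (h2.resolve_left hca).symm))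
  | triple n p hp ε _ =>
    have hx' : tripleAtom n p hp ε ∉ F ∪ X.image baseAtom := by
      simp only [Finset.mem_union, Finset.mem_image, not_or, not_exists, not_and]
      exact ⟨hx, fun _ _ => baseAtom_ne_tripleAtom⟩
    -- The flip fixes `F` and `X` pointwise, so the twin of `x` is an allowed image and must be `y`.
    obtain ⟨H, hH, e⟩ := exists_flip hF' hx'
    have hy : y = tripleAtom n p hp (1 + ε) := by
      have h1 := h H (hstab H hH)
      rw [e] at h1
      refine (h1.resolve_left fun h2 => ?_).symm
      simpa using (tripleAtom_inj.1 h2).2.2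
    refine ⟨n, p, hp, ε, rfl, hy, fun z hz => ?_⟩
    -- Both possible images of `x` have the index sequence `p`, so `H` fixes `p` entrywise. Hence
    -- the entries lie in `F` or `X`, and those of `X` can be moved within `X`.
    have hzfix : ∀ H, StabilizesOver F X H → H.1 z = z := fun H hH => by
      obtain ⟨δ, hδ⟩ := group_apply_tripleAtom H n p hp
      have h1 := h H hH
      rw [hδ, hy, tripleAtom_inj, tripleAtom_inj] at h1
      exact map_eq_self.1 (h1.elim (fun h => h.2.1) (fun h => h.2.1)) z hz
    rcases Finset.mem_union.1 (mem_of_fixed hF' fun H hH => hzfix H (hstab H hH)) with hzF | hzX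
    · exact hzF
    · exfalso
      obtain ⟨a, ha, rfl⟩ := Finset.mem_image.1 hzX
      obtain ⟨b, hb, hba⟩ := Finset.exists_mem_ne (show 1 < X.card by omega) a
      obtain ⟨H, hH, e⟩ := exists_stabilizesOver_swap hF (hX a ha) (hX b hb)
        (iff_of_true ha hb)
      exact hba (baseAtom_injective (e.symm.trans (hzfix H hH)))

theorem not_cardEq_twoSubsets_finiteSubsets :
    ¬ CardEq (twoSubsets (group A₀)) (finiteSubsets (group A₀)) := by
  classical
  rintro ⟨f, hf, hsurj⟩
  obtain ⟨F, hF, hfix⟩ := exists_isClosedSet_support f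
  obtain ⟨X, hX, hcard⟩ : ∃ X : Finset A₀, (∀ a ∈ X, baseAtom a ∉ F) ∧ X.card = 3 := by
    have hfin := F.finite_toSet.preimage (f := baseAtom) baseAtom_injective.injOn
    obtain ⟨X, hX, hc⟩ := hfin.infinite_compl.exists_subset_card_eq 3
    exact ⟨X, fun a ha => hX ha, hc⟩
  obtain ⟨q, hq⟩ := hsurj (ofFinset (X.image baseAtom)) (mem_mk.2 ⟨_, rfl⟩)
  obtain ⟨⟨⟨x, y⟩, hxy⟩, rfl⟩ := mem_mk.1 (hf.1.mem_of_maps hq).1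
  simp only at hq hxy
  have hstab : ∀ H, StabilizesOver F X H →
      (H.1 x = x ∧ H.1 y = y) ∨ (H.1 x = y ∧ H.1 y = x) := by
    intro H hH
    have h := (act_eq_of_maps hf hq (hfix H hH.1)).2 (by
      rw [act_ofFinset]
      congr 1
      -- A permutation that maps a finite set into itself maps it onto itself.
      refine Finset.eq_of_subset_of_card_le (fun z hz => ?_) (by simp)
      obtain ⟨w, hw, rfl⟩ := Finset.mem_map.1 hz
      obtain ⟨a, ha, rfl⟩ := Finset.mem_image.1 hw
      obtain ⟨b, hb, e⟩ := hH.2 a ha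
      exact Finset.mem_image.2 ⟨b, hb, e.symm⟩)
    simpa [upair_inj] using h
  -- The invariance of `{x, y}` no longer requires that `H` preserves `X`, which is what contradicts
  -- the dependence of the image on `X`.
  have hinv : ∀ H : group A₀, (∀ z ∈ F, H.1 z = z) →
      act H (upair (atom x) (atom y)) = (upair (atom x) (atom y) : Model A₀) := by
    have htwins : ∀ (n : ℕ) (p : List (Atom A₀)) (hp : IsIndex n p), (∀ z ∈ p, z ∈ F) →
        ∀ H : group A₀, (∀ z ∈ F, H.1 z = z) → act H (twins n p hp) = twins n p hp := by
      intro n p hp hpF H hH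
      rw [act_twins, twins_inj]
      exact ⟨rfl, map_eq_self.2 fun z hz => hH z (hpF z hz)⟩
    intro H hH
    by_cases hx : x ∈ F
    · by_cases hy : y ∈ F
      · rw [act_upair, act_atom, act_atom, hH x hx, hH y hy]
      · obtain ⟨n, p, hp, ε, rfl, rfl, hpF⟩ := exists_tripleAtom_of_stabilized (y := x) hF hX
          hcard.ge hy fun H hH => (hstab H hH).imp And.right And.right
        have hcomm : ∀ a b : Model A₀, upair a b = upair b a :=
          fun a b => upair_inj.2 (Or.inr ⟨rfl, rfl⟩)
        rw [hcomm, upair_tripleAtom]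
        exact htwins n p hp hpF H hH
    · obtain ⟨n, p, hp, ε, rfl, rfl, hpF⟩ := exists_tripleAtom_of_stabilized (y := y) hF hX
        hcard.ge hx fun H hH => (hstab H hH).imp And.left And.left
      rw [upair_tripleAtom]
      exact htwins n p hp hpF H hH
  obtain ⟨a, ha⟩ : X.Nonempty := Finset.card_pos.1 (by omega)
  obtain ⟨b, hb⟩ := exists_baseAtom_notMem (F ∪ X.image baseAtom)
  rw [Finset.mem_union, not_or] at hb
  obtain ⟨H, h1, h2, _⟩ := exists_swap hF (hX a ha) hb.1
  have h := (act_eq_of_maps hf hq (hfix H h1)).1 (hinv H h1)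
  rw [act_ofFinset, ofFinset_injective.eq_iff] at h
  refine hb.2 (h ▸ ?_)
  rw [← h2]
  exact Finset.mem_map_of_mem H.1.toEmbedding (Finset.mem_image_of_mem _ ha)

end ReflectedN

open ReflectedN ZFA.PermutationModel in
/-- In the permutation model, let `A` be the set of atoms and `m = |A|`. Then
`m² < iseq(m) < [m]² < fin(m)`. -/
theorem mainTheorem3 (A₀ : Type*) [Infinite A₀] :
    ∃ A sq iseq pairs fin : ReflectedN.Model A₀,
      ZFA.IsSetOfAtoms A ∧ ZFA.IsSquare sq A ∧ ZFA.IsIseq iseq A ∧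
      ZFA.IsTwoSubsets pairs A ∧ ZFA.IsFin fin A ∧
      ZFA.CardLT sq iseq ∧ ZFA.CardLT iseq pairs ∧ ZFA.CardLT pairs fin :=
  ⟨atoms _, square _, iseq _, twoSubsets _, finiteSubsets _, isSetOfAtoms_atoms, isSquare_square,
    isIseq_iseq, isTwoSubsets_twoSubsets, isFin_finiteSubsets,
    ⟨cardLE_square_iseq, not_cardEq_square_iseq⟩,
    ⟨cardLE_iseq_twoSubsets, not_cardEq_iseq_twoSubsets⟩,
    ⟨cardLE_twoSubsets_finiteSubsets, not_cardEq_twoSubsets_finiteSubsets⟩⟩
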